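/- Let $0<\alpha<\beta<L$, let $\kappa_1,\kappa_2,\kappa_3,\tau>0$, and let $\delta_1>0$, $\delta_2\in\mathbb R\setminus\{0\}$ with $|\delta_2|<\delta_1$. All functions are complex valued. Put $L^2_*(\alpha,\beta)=\{z\in L^2(\alpha,\beta):\int_\alpha^\beta z\,dx=0\}$, $H^1_*(\alpha,\beta)=H^1(\alpha,\beta)\cap L^2_*(\alpha,\beta)$, $\mathbb L^2_*=L^2(0,\alpha)\times L^2_*(\alpha,\beta)\times L^2(\beta,L)$, $$\mathbb H^1_*=\{(u,v,w)\in H^1(0,\alpha)\times H^1_*(\alpha,\beta)\times H^1(\beta,L):\ u(0)=0,\ u(\alpha)=v(\alpha),\ v(\beta)=w(\beta),\ w(L)=0\},$$ $\mathbb H^2=H^2(0,\alpha)\times H^2(\alpha,\beta)\times H^2(\beta,L)$, and $\mathcal H_2=\mathbb H^1_*\times\mathbb L^2_*\times L^2((0,1);H^1_*(\alpha,\beta))$, with the inner product $$\langle U,\tilde U\rangle=\kappa_1\int_0^\alpha u_x\overline{\tilde u_x}+\kappa_2\int_\alpha^\beta v_x\overline{\tilde v_x}+\kappa_3\int_\beta^L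 w_x\overline{\tilde w_x}+\int_0^\alpha y\overline{\tilde y}+\int_\alpha^\beta z\overline{\tilde z}+\int_\beta^L\phi\overline{\tilde\phi}+\tau|\delta_2|\int_0^1\!\int_\alpha^\beta\eta_x\overline{\tilde\eta_x}\,dx\,d\rho$$ for $U=(u,v,w,y,z,\phi,\eta)$, $\tilde U=(\tilde u,\tilde v,\tilde w,\tilde y,\tilde z,\tilde\phi,\tilde\eta)$, and with the corresponding norm $\|\cdot\|$. Let $\mathcal A_2:D(\mathcal A_2)\subset\mathcal H_2\to\mathcal H_2$ be the operator $$\mathcal A_2U=\bigl(y,\,z,\,\phi,\,\kappa_1u_{xx},\,(\kappa_2v_x+\delta_1z_x+\delta_2\eta_x(\cdot,1))_x,\,\kappa_3w_{xx},\,-\tau^{-1}\eta_\rho\bigr),$$ whose domain consists of all $U=(u,v,w,y,z,\phi,\eta)\in\mathcal H_2$ such that $(y,z,\phi)\in\mathbb H^1_*$, $\eta_\rho\in L^2((0,1);H^1_*(\alpha,\beta))$, $\eta(\cdot,0)=z$, $(u,\kappa_2v+\delta_1z+\delta_2\eta(\cdot,1),w)\in\mathbb H^2$, $\kappa_2v_x(\alpha)+\delta_1z_x(\alpha)+\delta_2\eta_x(\alpha,1)=\kappa_1u_x(\alpha)$,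 $\kappa_2v_x(\beta)+\delta_1z_x(\beta)+\delta_2\eta_x(\beta,1)=\kappa_3w_x(\beta)$, and $(\kappa_2v_x+\delta_1z_x+\delta_2\eta_x(\cdot,1))_x$ has mean value zero on $(\alpha,\beta)$ (so that $\mathcal A_2U\in\mathcal H_2$). **Proposition.** There are constants $K_1,K_2>0$, depending only on $\alpha,\beta,L,\kappa_1,\kappa_2,\kappa_3,\tau,\delta_1,\delta_2$, such that for all real $\lambda\ne0$, all $U\in D(\mathcal A_2)$ and all $F\in\mathcal H_2$ with $(i\lambda I-\mathcal A_2)U=F$, $$\|U\|^2\le K_1\,\lambda^{-4}(|\lambda|+1)^6\bigl(\|F\|\,\|U\|+\|F\|^2\bigr),$$ and, for every $M>0$ with $|\lambda|\ge M$, also $$\|U\|^2\le K_2\Bigl(\sqrt M+\frac1{\sqrt M}\Bigr)^2|\lambda|^{\frac12}\bigl(1+|\lambda|^{-\frac12}\bigr)^8\bigl(\|F\|\,\|U\|+\|F\|^2\bigr).$$ -/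

import Mathlib

open MeasureTheory Set
open scoped ContDiff

noncomputable section

namespace KVDelay

/-! ### One-dimensional Lebesgue and Sobolev spaces on a bounded interval -/

section Sobolev

variable {E : Type*} [NormedAddCommGroup E]

/-- The space `L²((a,b); E)`. -/
abbrev L2 (a b : ℝ) (E : Type*) [NormedAddCommGroup E] : Type _ :=
  Lp E 2 (volume.restrict (Ioo a b))

/-- `f` has the trace (point value) `t` at `c ∈ [a,b]`: `f` has a representative which is continuous
on `[a,b]` and takes the value `t` at `c`. -/
def HasTrace (a b : ℝ) (f : L2 a b E) (c : ℝ) (t : E) : Prop :=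
  ∃ r : ℝ → E, ContinuousOn r (Icc a b) ∧ f =ᵐ[volume.restrict (Ioo a b)] r ∧ r c = t

theorem L2.integrable {a b : ℝ} (f : L2 a b E) :
    Integrable (fun x => f x) (volume.restrict (Ioo a b)) :=
  (Lp.memLp f).integrable (by norm_num)

theorem HasTrace.add {a b c : ℝ} {f g : L2 a b E} {s t : E}
    (hf : HasTrace a b f c s) (hg : HasTrace a b g c t) : HasTrace a b (f + g) c (s + t) := by
  obtain ⟨r, hr, hfr, rfl⟩ := hf
  obtain ⟨q, hq, hgq, rfl⟩ := hg
  refine ⟨r + q, hr.add hq, ?_, rfl⟩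
  filter_upwards [Lp.coeFn_add f g, hfr, hgq] with x h1 h2 h3
  rw [h1, Pi.add_apply, Pi.add_apply, h2, h3]

theorem HasTrace.zero {a b c : ℝ} : HasTrace a b (0 : L2 a b E) c 0 :=
  ⟨0, continuousOn_const, Lp.coeFn_zero _ _ _, rfl⟩

theorem HasTrace.smul {E : Type*} [NormedAddCommGroup E] [NormedSpace ℂ E] {a b c : ℝ}
    {f : L2 a b E} {s : E} (k : ℂ) (hf : HasTrace a b f c s) :
    HasTrace a b (k • f) c (k • s) := by
  obtain ⟨r, hr, hfr, rfl⟩ := hf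
  refine ⟨k • r, hr.const_smul k, ?_, rfl⟩
  filter_upwards [Lp.coeFn_smul k f, hfr] with x h1 h2
  rw [h1, Pi.smul_apply, Pi.smul_apply, h2]

theorem HasTrace.unique {a b c : ℝ} (hab : a < b) (hc : c ∈ Icc a b) {f : L2 a b E} {s t : E}
    (h1 : HasTrace a b f c s) (h2 : HasTrace a b f c t) : s = t := by
  obtain ⟨r, hr, hfr, rfl⟩ := h1
  obtain ⟨q, hq, hgq, rfl⟩ := h2
  have h : r =ᵐ[volume.restrict (Icc a b)] q := by
    rw [← Measure.restrict_congr_set (Ioo_ae_eq_Icc (μ := volume) (a := a) (b := b))]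
    exact hfr.symm.trans hgq
  exact Measure.eqOn_Icc_of_ae_eq volume hab.ne h hr hq hc

variable [NormedSpace ℝ E]

/-- `g ∈ L²((a,b); E)` is the weak derivative of `f ∈ L²((a,b); E)`:
`∫ φ' f = - ∫ φ g` for all test functions `φ ∈ C_c^∞(a,b)`. -/
def HasWeakDeriv (a b : ℝ) (f g : L2 a b E) : Prop :=
  ∀ φ : ℝ → ℝ, ContDiff ℝ ∞ φ → HasCompactSupport φ → tsupport φ ⊆ Ioo a b →
    ∫ x in Ioo a b, deriv φ x • f x = - ∫ x in Ioo a b, φ x • g x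

theorem L2.integrable_smul {a b : ℝ} (f : L2 a b E) {φ : ℝ → ℝ} (hφ : Continuous φ)
    (hc : HasCompactSupport φ) :
    Integrable (fun x => φ x • f x) (volume.restrict (Ioo a b)) := by
  obtain ⟨C, hC⟩ := hc.exists_bound_of_continuous hφ
  exact (L2.integrable f).bdd_smul C hφ.aestronglyMeasurable (Filter.Eventually.of_forall hC)

theorem HasWeakDeriv.add {a b : ℝ} {f g f₁ g₁ : L2 a b E}
    (h : HasWeakDeriv a b f g) (h₁ : HasWeakDeriv a b f₁ g₁) :
    HasWeakDeriv a b (f + f₁) (g + g₁) := by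
  intro φ hφ hc hs
  have hd : Continuous (deriv φ) := hφ.continuous_deriv (by simp)
  have e1 : ∫ x in Ioo a b, deriv φ x • (f + f₁ : L2 a b E) x
      = ∫ x in Ioo a b, (deriv φ x • f x + deriv φ x • f₁ x) := by
    refine integral_congr_ae ?_
    filter_upwards [Lp.coeFn_add f f₁] with x hx
    rw [hx, Pi.add_apply, smul_add]
  have e2 : ∫ x in Ioo a b, φ x • (g + g₁ : L2 a b E) x
      = ∫ x in Ioo a b, (φ x • g x + φ x • g₁ x) := by
    refine integral_congr_ae ?_
    filter_upwards [Lp.coeFn_add g g₁] with x hx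
    rw [hx, Pi.add_apply, smul_add]
  rw [e1, e2, integral_add (L2.integrable_smul f hd hc.deriv) (L2.integrable_smul f₁ hd hc.deriv),
    integral_add (L2.integrable_smul g hφ.continuous hc) (L2.integrable_smul g₁ hφ.continuous hc),
    h φ hφ hc hs, h₁ φ hφ hc hs, neg_add]

theorem HasWeakDeriv.zero {a b : ℝ} : HasWeakDeriv a b (0 : L2 a b E) 0 := by
  intro φ _ _ _
  have e : ∀ ψ : ℝ → ℝ, ∫ x in Ioo a b, ψ x • (0 : L2 a b E) x = 0 := by
    intro ψ
    rw [← integral_zero ℝ E (μ := volume.restrict (Ioo a b))]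
    refine integral_congr_ae ?_
    filter_upwards [Lp.coeFn_zero E 2 (volume.restrict (Ioo a b))] with x hx
    rw [hx, Pi.zero_apply, smul_zero]
  rw [e, e, neg_zero]

theorem HasWeakDeriv.smul {E : Type*} [NormedAddCommGroup E] [NormedSpace ℂ E] {a b : ℝ}
    {f g : L2 a b E} (k : ℂ) (h : HasWeakDeriv a b f g) :
    HasWeakDeriv a b (k • f) (k • g) := by
  have e : ∀ (ψ : ℝ → ℝ) (f : L2 a b E), ∫ x in Ioo a b, ψ x • (k • f : L2 a b E) x
      = k • ∫ x in Ioo a b, ψ x • f x := by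
    intro ψ f
    rw [← integral_smul]
    refine integral_congr_ae ?_
    filter_upwards [Lp.coeFn_smul k f] with x hx
    rw [hx, Pi.smul_apply, smul_comm]
  intro φ hφ hc hs
  rw [e, e, h φ hφ hc hs, smul_neg]

theorem HasWeakDeriv.unique [CompleteSpace E] {a b : ℝ} {f g g₁ : L2 a b E}
    (h : HasWeakDeriv a b f g) (h₁ : HasWeakDeriv a b f g₁) : g = g₁ := by
  have hi : LocallyIntegrableOn (fun x => g x - g₁ x) (Ioo a b) volume :=
    (IntegrableOn.locallyIntegrableOn (L2.integrable g)).sub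
      (IntegrableOn.locallyIntegrableOn (L2.integrable g₁))
  have key := isOpen_Ioo.ae_eq_zero_of_integral_contDiff_smul_eq_zero hi (by
    intro φ hφ hc hs
    have e : ∫ x, φ x • (g x - g₁ x) = ∫ x in Ioo a b, φ x • (g x - g₁ x) := by
      rw [setIntegral_eq_integral_of_forall_compl_eq_zero]
      intro x hx
      rw [image_eq_zero_of_notMem_tsupport (fun h => hx (hs h)), zero_smul]
    simp only [smul_sub] at e ⊢
    rw [e, integral_sub (L2.integrable_smul g hφ.continuous hc)
      (L2.integrable_smul g₁ hφ.continuous hc), sub_eq_zero]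
    exact neg_injective ((h φ hφ hc hs).symm.trans (h₁ φ hφ hc hs)))
  refine Lp.ext ?_
  rw [Filter.EventuallyEq, ae_restrict_iff' measurableSet_Ioo]
  filter_upwards [key] with x hx hxI
  exact sub_eq_zero.mp (hx hxI)

/-- The complex Sobolev space `H¹(a,b)` as a subspace of `L²(a,b) × L²(a,b)`: an element is a
function `f ∈ L²(a,b)` together with its (unique) weak derivative `f_x ∈ L²(a,b)`; the norm is
`(‖f‖² + ‖f_x‖²)^{1/2}`. -/
def H1sub (a b : ℝ) : Submodule ℂ (WithLp 2 (L2 a b ℂ × L2 a b ℂ)) where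
  carrier := {p | HasWeakDeriv a b p.fst p.snd}
  add_mem' h h₁ := h.add h₁
  zero_mem' := HasWeakDeriv.zero
  smul_mem' k _ h := h.smul k

/-- The complex Sobolev space `H¹(a,b)`. -/
def H1 (a b : ℝ) : Type := H1sub a b

instance (a b : ℝ) : NormedAddCommGroup (H1 a b) := inferInstanceAs (NormedAddCommGroup (H1sub a b))
instance (a b : ℝ) : InnerProductSpace ℂ (H1 a b) :=
  inferInstanceAs (InnerProductSpace ℂ (H1sub a b))

/-- The underlying `L²` function of an element of `H¹(a,b)`. -/
def H1.fn {a b : ℝ} (u : H1 a b) : L2 a b ℂ := u.1.fst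

/-- The weak derivative `u_x` of an element `u` of `H¹(a,b)`. -/
def H1.dx {a b : ℝ} (u : H1 a b) : L2 a b ℂ := u.1.snd

theorem H1.hasWeakDeriv {a b : ℝ} (u : H1 a b) : HasWeakDeriv a b u.fn u.dx := u.2

theorem H1.ext_fn {a b : ℝ} {u v : H1 a b} (h : u.fn = v.fn) : u = v := by
  have hu := u.hasWeakDeriv
  rw [h] at hu
  exact Subtype.ext (WithLp.ofLp_injective 2 (Prod.ext h (hu.unique v.hasWeakDeriv)))

/-- `L²_*(a,b)`: the square integrable functions with mean value zero. -/
def L2star (a b : ℝ) : Submodule ℂ (L2 a b ℂ) where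
  carrier := {f | ∫ x in Ioo a b, f x = 0}
  add_mem' {f g} hf hg := by
    simp only [mem_ofPred_eq] at hf hg ⊢
    rw [integral_congr_ae (Lp.coeFn_add f g)]
    simp only [Pi.add_apply]
    rw [integral_add (L2.integrable f) (L2.integrable g), hf, hg, add_zero]
  zero_mem' := by
    simp only [mem_ofPred_eq]
    rw [integral_congr_ae (Lp.coeFn_zero _ _ _)]
    simp
  smul_mem' k f hf := by
    simp only [mem_ofPred_eq] at hf ⊢
    rw [integral_congr_ae (Lp.coeFn_smul k f)]
    simp only [Pi.smul_apply]
    rw [integral_smul, hf, smul_zero]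

/-- `H¹_*(a,b) = H¹(a,b) ∩ L²_*(a,b)` as a subspace of `H¹(a,b)`. -/
def H1starSub (a b : ℝ) : Submodule ℂ (H1 a b) where
  carrier := {u | u.fn ∈ L2star a b}
  add_mem' hu hv := (L2star a b).add_mem hu hv
  zero_mem' := (L2star a b).zero_mem
  smul_mem' k _ hu := (L2star a b).smul_mem k hu

/-- `H¹_*(a,b) = H¹(a,b) ∩ L²_*(a,b)`, with the norm of `H¹(a,b)`. -/
def H1star (a b : ℝ) : Type := H1starSub a b

instance (a b : ℝ) : NormedAddCommGroup (H1star a b) :=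
  inferInstanceAs (NormedAddCommGroup (H1starSub a b))
instance (a b : ℝ) : InnerProductSpace ℂ (H1star a b) :=
  inferInstanceAs (InnerProductSpace ℂ (H1starSub a b))

/-- An element of `H¹_*(a,b)` as an element of `H¹(a,b)`. -/
def H1star.toH1 {a b : ℝ} (u : H1star a b) : H1 a b := u.1

/-- An element of `H¹_*(a,b)` as an element of `L²_*(a,b)`. -/
def H1star.toL2star {a b : ℝ} (u : H1star a b) : L2star a b := ⟨u.toH1.fn, u.2⟩

/-- The weak derivative of an element of `H¹_*(a,b)`. -/
def H1star.dx {a b : ℝ} (u : H1star a b) : L2 a b ℂ := u.toH1.dx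

theorem continuous_integral_smul {a b : ℝ} {φ : ℝ → ℝ} (hφ : Continuous φ) :
    Continuous fun f : L2 a b ℂ => ∫ x in Ioo a b, φ x • f x := by
  obtain ⟨C, hC⟩ := (isCompact_Icc (a := a) (b := b)).exists_bound_of_continuousOn
    hφ.continuousOn
  have hm : MemLp (fun x => (φ x : ℂ)) 2 (volume.restrict (Ioo a b)) := by
    refine MemLp.of_bound (Complex.continuous_ofReal.comp hφ).aestronglyMeasurable C ?_
    rw [ae_restrict_iff' measurableSet_Ioo]
    refine Filter.Eventually.of_forall fun x hx => ?_
    simpa using hC x (Ioo_subset_Icc_self hx)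
  have e : (fun f : L2 a b ℂ => ∫ x in Ioo a b, φ x • f x)
      = fun f => inner ℂ (hm.toLp _) f := by
    funext f
    rw [L2.inner_def]
    refine integral_congr_ae ?_
    filter_upwards [hm.coeFn_toLp] with x hx
    simp [hx, mul_comm]
  rw [e]
  exact continuous_const.inner continuous_id

theorem isClosed_H1sub (a b : ℝ) :
    IsClosed (H1sub a b : Set (WithLp 2 (L2 a b ℂ × L2 a b ℂ))) := by
  have e : (H1sub a b : Set (WithLp 2 (L2 a b ℂ × L2 a b ℂ)))
      = ⋂ φ : {φ : ℝ → ℝ // ContDiff ℝ ∞ φ ∧ HasCompactSupport φ ∧ tsupport φ ⊆ Ioo a b},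
        {p | ∫ x in Ioo a b, deriv φ.1 x • p.fst x = - ∫ x in Ioo a b, φ.1 x • p.snd x} := by
    ext p
    simp only [mem_iInter, Subtype.forall, mem_ofPred_eq]
    exact ⟨fun h φ hφ => h φ hφ.1 hφ.2.1 hφ.2.2, fun h φ h1 h2 h3 => h φ ⟨h1, h2, h3⟩⟩
  rw [e]
  refine isClosed_iInter fun φ => isClosed_eq ?_ ?_
  · exact (continuous_integral_smul (φ.2.1.continuous_deriv (by simp))).comp
      (WithLp.prod_continuous_ofLp 2 _ _).fst
  · exact ((continuous_integral_smul φ.2.1.continuous).comp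
      (WithLp.prod_continuous_ofLp 2 _ _).snd).neg

instance (a b : ℝ) : CompleteSpace (H1 a b) := (isClosed_H1sub a b).completeSpace_coe

theorem isClosed_H1starSub (a b : ℝ) : IsClosed (H1starSub a b : Set (H1 a b)) := by
  have h := continuous_integral_smul (a := a) (b := b) (φ := fun _ => 1) continuous_const
  simp only [one_smul] at h
  have h' : Continuous fun u : H1 a b => u.fn :=
    (WithLp.prod_continuous_ofLp 2 _ _).fst.comp
      (continuous_subtype_val (p := fun x => x ∈ H1sub a b))
  exact isClosed_eq (h.comp h') continuous_const

instance (a b : ℝ) : CompleteSpace (H1star a b) := (isClosed_H1starSub a b).completeSpace_coe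

end Sobolev

/-! ### The energy space and the operator -/

/-- The parameters of the system. -/
structure Params where
  /-- left end of the damped region -/
  α : ℝ
  /-- right end of the damped region -/
  β : ℝ
  /-- length of the string -/
  L : ℝ
  /-- stiffness on `(0,α)` -/
  κ₁ : ℝ
  /-- stiffness on `(α,β)` -/
  κ₂ : ℝ
  /-- stiffness on `(β,L)` -/
  κ₃ : ℝ
  /-- time delay -/
  τ : ℝ
  /-- coefficient of the Kelvin-Voigt damping -/
  δ₁ : ℝ
  /-- coefficient of the delayed term -/
  δ₂ : ℝ

variable (p : Params)

/-- The space `ℍ¹_*` of triples `(u,v,w) ∈ H¹(0,α) × H¹_*(α,β) × H¹(β,L)` with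
`u(0) = 0`, `u(α) = v(α)`, `v(β) = w(β)`, `w(L) = 0`, as a subspace. -/
def HH1sub : Submodule ℂ (H1 0 p.α × H1star p.α p.β × H1 p.β p.L) where
  carrier := {q |
    HasTrace 0 p.α q.1.fn 0 0 ∧
    (∃ t : ℂ, HasTrace 0 p.α q.1.fn p.α t ∧ HasTrace p.α p.β q.2.1.toH1.fn p.α t) ∧
    (∃ t : ℂ, HasTrace p.α p.β q.2.1.toH1.fn p.β t ∧ HasTrace p.β p.L q.2.2.fn p.β t) ∧
    HasTrace p.β p.L q.2.2.fn p.L 0}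
  add_mem' := by
    rintro q r ⟨h1, ⟨s, h2, h3⟩, ⟨t, h4, h5⟩, h6⟩ ⟨k1, ⟨s', k2, k3⟩, ⟨t', k4, k5⟩, k6⟩
    refine ⟨?_, ⟨s + s', h2.add k2, h3.add k3⟩, ⟨t + t', h4.add k4, h5.add k5⟩, ?_⟩
    · have := h1.add k1
      rwa [add_zero] at this
    · have := h6.add k6
      rwa [add_zero] at this
  zero_mem' := ⟨HasTrace.zero, ⟨0, HasTrace.zero, HasTrace.zero⟩,
    ⟨0, HasTrace.zero, HasTrace.zero⟩, HasTrace.zero⟩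
  smul_mem' := by
    rintro k q ⟨h1, ⟨s, h2, h3⟩, ⟨t, h4, h5⟩, h6⟩
    refine ⟨?_, ⟨k • s, h2.smul k, h3.smul k⟩, ⟨k • t, h4.smul k, h5.smul k⟩, ?_⟩
    · have := h1.smul k
      rwa [smul_zero] at this
    · have := h6.smul k
      rwa [smul_zero] at this

/-- The space `ℍ¹_*`. -/
def HH1 : Type := HH1sub p

instance : AddCommGroup (HH1 p) := inferInstanceAs (AddCommGroup (HH1sub p))
instance : Module ℂ (HH1 p) := inferInstanceAs (Module ℂ (HH1sub p))

/-- The space `𝕃²_* = L²(0,α) × L²_*(α,β) × L²(β,L)`. -/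
abbrev LL2 : Type := L2 0 p.α ℂ × L2star p.α p.β × L2 p.β p.L ℂ

/-- The energy space `𝓗₂ = ℍ¹_* × 𝕃²_* × L²((0,1); H¹_*(α,β))`, with elements
`((u,v,w), (y,z,ϕ), η)`. -/
abbrev Energy : Type := HH1 p × LL2 p × L2 0 1 (H1star p.α p.β)

variable {p}

/-- First component of an element of `ℍ¹_*`. -/
def HH1.left (q : HH1 p) : H1 0 p.α := q.1.1

/-- Second component of an element of `ℍ¹_*`. -/
def HH1.mid (q : HH1 p) : H1star p.α p.β := q.1.2.1

/-- Third component of an element of `ℍ¹_*`. -/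
def HH1.right (q : HH1 p) : H1 p.β p.L := q.1.2.2

/-- The embedding of `ℍ¹_*` into `𝕃²_*`. -/
def HH1.toLL2 (q : HH1 p) : LL2 p := (q.left.fn, q.mid.toL2star, q.right.fn)

theorem HH1.toLL2_injective : Function.Injective (HH1.toLL2 (p := p)) := by
  intro q r h
  have h1 : q.left.fn = r.left.fn := congrArg (fun s : LL2 p => s.1) h
  have h2 : q.mid.toH1.fn = r.mid.toH1.fn :=
    congrArg (fun s : LL2 p => (s.2.1 : L2 p.α p.β ℂ)) h
  have h3 : q.right.fn = r.right.fn := congrArg (fun s : LL2 p => s.2.2) h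
  exact Subtype.ext (Prod.ext (H1.ext_fn h1)
    (Prod.ext (Subtype.ext (H1.ext_fn h2)) (H1.ext_fn h3)))

/-- The inner product `⟨U, V⟩` of the energy space (linear in `U`, conjugate linear in `V`); note
that `inner ℂ f g = ∫ conj(f) g` in `L²`. -/
def energyInner (U V : Energy p) : ℂ :=
  p.κ₁ * inner ℂ V.1.left.dx U.1.left.dx
  + p.κ₂ * inner ℂ V.1.mid.dx U.1.mid.dx
  + p.κ₃ * inner ℂ V.1.right.dx U.1.right.dx
  + inner ℂ V.2.1.1 U.2.1.1
  + inner ℂ (V.2.1.2.1 : L2 p.α p.β ℂ) (U.2.1.2.1 : L2 p.α p.β ℂ)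
  + inner ℂ V.2.1.2.2 U.2.1.2.2
  + p.τ * |p.δ₂| * ∫ ρ in Ioo (0 : ℝ) 1,
      inner ℂ (V.2.2 ρ).dx (U.2.2 ρ).dx

/-- The energy norm `‖U‖ = ⟨U, U⟩^{1/2}`. -/
def energyNorm (U : Energy p) : ℝ := Real.sqrt (energyInner U U).re

/-- `κ₂ v + δ₁ z + δ₂ η(·,1)` as an element of `H¹_*(α,β)`. -/
def flux (v z η₁ : H1star p.α p.β) : H1star p.α p.β :=
  (p.κ₂ : ℂ) • v + (p.δ₁ : ℂ) • z + (p.δ₂ : ℂ) • η₁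

/-- `IsA2 U V` says that `U = ((u,v,w), (y,z,ϕ), η) ∈ 𝓗₂` lies in the domain of the operator `𝓐₂`
and that `V = 𝓐₂ U ∈ 𝓗₂`. -/
def IsA2 (U V : Energy p) : Prop :=
  ∃ (Y : HH1 p) (η₀ η₁ : H1star p.α p.β) (ηρ : L2 0 1 (H1star p.α p.β))
    (uxx : L2 0 p.α ℂ) (qx : L2star p.α p.β) (wxx : L2 p.β p.L ℂ),
    -- `(y,z,ϕ) ∈ ℍ¹_*`
    Y.toLL2 = U.2.1 ∧
    -- `η_ρ ∈ L²((0,1); H¹_*(α,β))`, with `η₀ = η(·,0)` and `η₁ = η(·,1)`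
    HasWeakDeriv 0 1 U.2.2 ηρ ∧ HasTrace 0 1 U.2.2 0 η₀ ∧ HasTrace 0 1 U.2.2 1 η₁ ∧
    -- `z = η(·,0)`
    Y.mid = η₀ ∧
    -- `(u, κ₂ v + δ₁ z + δ₂ η(·,1), w) ∈ ℍ²`
    HasWeakDeriv 0 p.α U.1.left.dx uxx ∧
    HasWeakDeriv p.α p.β (flux U.1.mid Y.mid η₁).dx qx ∧
    HasWeakDeriv p.β p.L U.1.right.dx wxx ∧
    -- `κ₂ v_x(α) + δ₁ z_x(α) + δ₂ η_x(α,1) = κ₁ u_x(α)`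
    (∃ t : ℂ, HasTrace p.α p.β (flux U.1.mid Y.mid η₁).dx p.α (p.κ₁ * t) ∧
      HasTrace 0 p.α U.1.left.dx p.α t) ∧
    -- `κ₂ v_x(β) + δ₁ z_x(β) + δ₂ η_x(β,1) = κ₃ w_x(β)`
    (∃ t : ℂ, HasTrace p.α p.β (flux U.1.mid Y.mid η₁).dx p.β (p.κ₃ * t) ∧
      HasTrace p.β p.L U.1.right.dx p.β t) ∧
    V = (Y, ((p.κ₁ : ℂ) • uxx, qx, (p.κ₃ : ℂ) • wxx), -((p.τ : ℂ)⁻¹ • ηρ))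

variable (p)

/-- The graph of `𝓐₂`. -/
def A2graph : Submodule ℂ (Energy p × Energy p) where
  carrier := {q | IsA2 q.1 q.2}
  add_mem' := by
    rintro ⟨U, V⟩ ⟨U', V'⟩
      ⟨Y, η₀, η₁, ηρ, uxx, qx, wxx, h1, h2, h3, h4, h5, h6, h7, h8, ⟨s, h9, h10⟩, ⟨t, h11, h12⟩, rfl⟩
      ⟨Y', η₀', η₁', ηρ', uxx', qx', wxx', k1, k2, k3, k4, k5, k6, k7, k8, ⟨s', k9, k10⟩,
        ⟨t', k11, k12⟩, rfl⟩
    have e : (flux (U.1 + U'.1).mid (Y + Y').mid (η₁ + η₁')).dx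
        = (flux U.1.mid Y.mid η₁).dx + (flux U'.1.mid Y'.mid η₁').dx := by
      refine congrArg H1star.dx
        (?_ : _ = flux U.1.mid Y.mid η₁ + flux U'.1.mid Y'.mid η₁')
      change flux (U.1.mid + U'.1.mid) (Y.mid + Y'.mid) (η₁ + η₁') = _
      simp only [flux, smul_add]
      abel
    refine ⟨Y + Y', η₀ + η₀', η₁ + η₁', ηρ + ηρ', uxx + uxx', qx + qx', wxx + wxx', ?_, h2.add k2,
      h3.add k3, h4.add k4, ?_, h6.add k6, ?_, h8.add k8, ⟨s + s', ?_, h10.add k10⟩,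
      ⟨t + t', ?_, h12.add k12⟩, ?_⟩
    · exact congrArg₂ (· + ·) h1 k1
    · exact congrArg₂ (· + ·) h5 k5
    · exact (congrArg (HasWeakDeriv p.α p.β · _) e).mpr (h7.add k7)
    · exact (congrArg₂ (HasTrace p.α p.β · p.α ·) e (mul_add _ _ _)).mpr (h9.add k9)
    · exact (congrArg₂ (HasTrace p.α p.β · p.β ·) e (mul_add _ _ _)).mpr (h11.add k11)
    · simp only [Prod.mk_add_mk, smul_add, neg_add]
  zero_mem' := by
    have e : (flux (0 : H1star p.α p.β) 0 0).dx = 0 :=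
      congrArg H1star.dx (by simp [flux] : flux (0 : H1star p.α p.β) 0 0 = 0)
    refine ⟨0, 0, 0, 0, 0, 0, 0, rfl, HasWeakDeriv.zero, HasTrace.zero, HasTrace.zero, rfl,
      HasWeakDeriv.zero, ?_, HasWeakDeriv.zero, ⟨0, ?_, HasTrace.zero⟩, ⟨0, ?_, HasTrace.zero⟩, ?_⟩
    · exact (congrArg (HasWeakDeriv p.α p.β · _) e).mpr HasWeakDeriv.zero
    · exact (congrArg₂ (HasTrace p.α p.β · p.α ·) e (mul_zero _)).mpr HasTrace.zero
    · exact (congrArg₂ (HasTrace p.α p.β · p.β ·) e (mul_zero _)).mpr HasTrace.zero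
    · simp only [smul_zero, neg_zero]
      rfl
  smul_mem' := by
    rintro k ⟨U, V⟩
      ⟨Y, η₀, η₁, ηρ, uxx, qx, wxx, h1, h2, h3, h4, h5, h6, h7, h8, ⟨s, h9, h10⟩, ⟨t, h11, h12⟩, rfl⟩
    have e : (flux (k • U.1).mid (k • Y).mid (k • η₁)).dx = k • (flux U.1.mid Y.mid η₁).dx := by
      refine congrArg H1star.dx (?_ : _ = k • flux U.1.mid Y.mid η₁)
      change flux (k • U.1.mid) (k • Y.mid) (k • η₁) = _
      simp only [flux, smul_add, smul_comm k]
    refine ⟨k • Y, k • η₀, k • η₁, k • ηρ, k • uxx, k • qx, k • wxx, ?_, h2.smul k, h3.smul k,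
      h4.smul k, ?_, h6.smul k, ?_, h8.smul k, ⟨k • s, ?_, h10.smul k⟩, ⟨k • t, ?_, h12.smul k⟩, ?_⟩
    · exact congrArg (k • ·) h1
    · exact congrArg (k • ·) h5
    · exact (congrArg (HasWeakDeriv p.α p.β · _) e).mpr (h7.smul k)
    · exact (congrArg₂ (HasTrace p.α p.β · p.α ·) e (mul_smul_comm _ _ _)).mpr (h9.smul k)
    · exact (congrArg₂ (HasTrace p.α p.β · p.β ·) e (mul_smul_comm _ _ _)).mpr (h11.smul k)
    · simp only [Prod.smul_mk, smul_neg, smul_comm k]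

variable {p}

theorem IsA2.unique {U V V' : Energy p} (h : IsA2 U V) (h' : IsA2 U V') : V = V' := by
  obtain ⟨Y, η₀, η₁, ηρ, uxx, qx, wxx, h1, h2, -, h4, -, h6, h7, h8, -, -, rfl⟩ := h
  obtain ⟨Y', η₀', η₁', ηρ', uxx', qx', wxx', k1, k2, -, k4, -, k6, k7, k8, -, -, rfl⟩ := h'
  obtain rfl := HH1.toLL2_injective (h1.trans k1.symm)
  obtain rfl := h4.unique one_pos (right_mem_Icc.mpr zero_le_one) k4
  rw [h2.unique k2, h6.unique k6, Subtype.ext (h7.unique k7), h8.unique k8]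

variable (p)

/-- The unbounded operator `𝓐₂ : D(𝓐₂) ⊂ 𝓗₂ → 𝓗₂`,
`𝓐₂ U = (y, z, ϕ, κ₁ u_xx, (κ₂ v_x + δ₁ z_x + δ₂ η_x(·,1))_x, κ₃ w_xx, -τ⁻¹ η_ρ)`. -/
def A2 : Energy p →ₗ.[ℂ] Energy p := (A2graph p).toLinearPMap

variable {p}

/-- `𝓐₂` is the operator whose graph is described by `IsA2`. -/
theorem mem_graph_A2 {U V : Energy p} : (U, V) ∈ (A2 p).graph ↔ IsA2 U V := by
  have h : ∀ x ∈ A2graph p, x.1 = 0 → x.2 = 0 := by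
    rintro ⟨U, V⟩ hx (rfl : U = 0)
    exact IsA2.unique hx (A2graph p).zero_mem
  rw [A2, Submodule.toLinearPMap_graph_eq _ h]
  rfl

end KVDelay

end

/-! Write `N = ‖U‖`, `Φ = ‖F‖` and `r² = ΦN + Φ²`. The real part of `⟨F, U⟩` equals the dissipation.
The delay term contributes `(|δ₂|/2)(‖η_x(1)‖² - ‖z_x‖²)`, which absorbs the cross term `δ₂ ⟨η_x(1),
z_x⟩` and leaves `(δ₁ - |δ₂|)‖z_x‖²`, so `‖z_x‖ ≲ r`. Everything in the damped region follows: `‖z‖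
≲ r` by Poincaré for mean zero functions; `‖η_x‖, ‖η_x(1)‖ ≲ r` because the term `iτλη` in the
transport equation does not change `‖η_x(ρ)‖`; and `|λ|‖v_x‖ ≲ r` from `iλv - z = f₂`.

On the two undamped strings the energy density is, up to the data, the same at every point, so the
energy there is governed by the interface values of `u_x, w_x` and `z`. By the transmission
conditions the former are boundary values of the flux `q_x`, where `q = κ₂v + δ₁z + δ₂η(·,1)`, and
the trace inequality bounds them by `‖q_x‖` and `‖q_xx‖ ≤ |λ|‖z‖ + ‖g₂‖`.

For `|λ| ≤ 1` the bound `‖v_x‖ ≲ r/|λ|` is the only loss, which gives `N² ≲ λ⁻² r²`. For `|λ| ≥ 1`,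
pairing the equation for `q_xx` with `iz` bounds `|λ|‖z‖²` by products of flux traces and traces of
`z`. The growth of one factor cancels the smallness of the other, so `√|λ| ‖z‖ ≲ r`; the flux traces
squared are then `≲ √|λ| r²`, and `N² ≲ √|λ| r²`. Both weights in the theorem dominate these two
bounds.

The analysis is carried by `HasWeakDeriv.exists_isPrimitiveOn`, `HasWeakDeriv.inner_add_inner` and
`wave_norm_sq_le`. `IsA2.resolventBounds` condenses it into inequalities between real numbers, from
which the two regimes are derived. -/

noncomputable section

namespace KVDelay

/-! ### Primitives of integrable functions -/

section Primitive

variable {E F G : Type*} [NormedAddCommGroup E] [NormedSpace ℝ E]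
  [NormedAddCommGroup F] [NormedSpace ℝ F] [NormedAddCommGroup G] [NormedSpace ℝ G]

/-- On `[a,b]`, the function `f` is a primitive of the integrable function `f'`. -/
structure IsPrimitiveOn (a b : ℝ) (f f' : ℝ → E) : Prop where
  intervalIntegrable : IntervalIntegrable f' volume a b
  eq_add_integral : ∀ x ∈ Icc a b, f x = f a + ∫ t in a..x, f' t

/-- Increments of the vector-valued integral are dominated by increments of the integral of the
norm, so the scalar case suffices. -/
theorem _root_.IntervalIntegrable.absolutelyContinuousOnInterval_integral {f : ℝ → E} {a b : ℝ}
    (hf : IntervalIntegrable f volume a b) :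
    AbsolutelyContinuousOnInterval (fun x => ∫ t in a..x, f t) a b := by
  have hn := hf.norm.absolutelyContinuousOnInterval_intervalIntegral (c := a) left_mem_uIcc
  rw [absolutelyContinuousOnInterval_iff] at hn ⊢
  intro ε hε
  obtain ⟨δ, hδ, h⟩ := hn ε hε
  refine ⟨δ, hδ, fun I hI hI' => (Finset.sum_le_sum fun i hi => ?_).trans_lt (h I hI hI')⟩
  have hsub : ∀ x ∈ uIcc a b, IntervalIntegrable f volume a x := fun x hx =>
    hf.mono_set (uIcc_subset_uIcc_left hx)
  have h1 := hsub _ (hI.1 i hi).1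
  have h2 := hsub _ (hI.1 i hi).2
  rw [dist_eq_norm, Real.dist_eq, intervalIntegral.integral_interval_sub_left h1 h2,
    intervalIntegral.integral_interval_sub_left h1.norm h2.norm]
  exact intervalIntegral.norm_integral_le_abs_integral_norm

namespace IsPrimitiveOn

variable {a b : ℝ} {f f' : ℝ → E} {g g' : ℝ → F}

theorem absolutelyContinuousOnInterval (hab : a ≤ b) (h : IsPrimitiveOn a b f f') :
    AbsolutelyContinuousOnInterval f a b := by
  have hn := h.intervalIntegrable.absolutelyContinuousOnInterval_integral
  rw [absolutelyContinuousOnInterval_iff] at hn ⊢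
  intro ε hε
  obtain ⟨δ, hδ, k⟩ := hn ε hε
  refine ⟨δ, hδ, fun I hI hI' => (Finset.sum_congr rfl fun i hi => ?_).trans_lt (k I hI hI')⟩
  have h1 := (hI.1 i hi).1
  have h2 := (hI.1 i hi).2
  rw [uIcc_of_le hab] at h1 h2
  rw [h.eq_add_integral _ h1, h.eq_add_integral _ h2, dist_add_left]

theorem continuousOn (hab : a ≤ b) (h : IsPrimitiveOn a b f f') : ContinuousOn f (Icc a b) := by
  have := (h.absolutelyContinuousOnInterval hab).continuousOn
  rwa [uIcc_of_le hab] at this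

theorem ae_hasDerivAt [CompleteSpace E] (hab : a ≤ b) (h : IsPrimitiveOn a b f f') :
    ∀ᵐ x, x ∈ Ioo a b → HasDerivAt f (f' x) x := by
  filter_upwards [h.intervalIntegrable.ae_hasDerivAt_integral] with x hx hxI
  rw [uIcc_of_le hab] at hx
  refine ((hx (Ioo_subset_Icc_self hxI) a (left_mem_Icc.2 hab)).const_add (f a)).congr_of_eventuallyEq
    ?_
  filter_upwards [Ioo_mem_nhds hxI.1 hxI.2] with y hy
  exact h.eq_add_integral y (Ioo_subset_Icc_self hy)

/-- The difference between `f` and the integral of `f'` is absolutely continuous with derivative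
zero almost everywhere, hence constant. -/
theorem of_ae_hasDerivAt [CompleteSpace E] (hab : a ≤ b)
    (hf : AbsolutelyContinuousOnInterval f a b)
    (hf' : IntervalIntegrable f' volume a b) (h : ∀ᵐ x, x ∈ Ioo a b → HasDerivAt f (f' x) x) :
    IsPrimitiveOn a b f f' := by
  refine ⟨hf', ?_⟩
  obtain ⟨C, hC⟩ := (hf.sub hf'.absolutelyContinuousOnInterval_integral).const_of_ae_hasDerivAt_zero
    (by
      have h₁ : ∀ᵐ x : ℝ, x ≠ a := by simp [ae_iff, measure_singleton]
      have h₂ : ∀ᵐ x : ℝ, x ≠ b := by simp [ae_iff, measure_singleton]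
      filter_upwards [h, hf'.ae_hasDerivAt_integral, h₁, h₂] with x hx hx' ha hb hxI
      have hI := hxI
      rw [uIcc_of_le hab] at hI
      have := (hx ⟨lt_of_le_of_ne hI.1 ha.symm, lt_of_le_of_ne hI.2 hb⟩).sub
        (hx' hxI a left_mem_uIcc)
      rwa [sub_self] at this)
  rw [uIcc_of_le hab] at hC
  intro x hx
  have h1 := hC x hx
  have h2 := hC a (left_mem_Icc.2 hab)
  simp only [Pi.sub_apply, intervalIntegral.integral_same, sub_zero] at h1 h2
  rw [h2, ← h1]
  abel

/-- The product rule behind every integration by parts below; it is used for scalar multiplication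
and for the real inner product. -/
theorem bilin [CompleteSpace E] [CompleteSpace F] [CompleteSpace G] (hab : a ≤ b)
    (B : E →L[ℝ] F →L[ℝ] G) (hf : IsPrimitiveOn a b f f') (hg : IsPrimitiveOn a b g g') :
    IsPrimitiveOn a b (fun x => B (f x) (g x)) (fun x => B (f' x) (g x) + B (f x) (g' x)) := by
  have hfc := hf.continuousOn hab
  have hgc := hg.continuousOn hab
  refine of_ae_hasDerivAt hab ?_ ?_ ?_
  · have hf1 := hf.absolutelyContinuousOnInterval hab
    have hg1 := hg.absolutelyContinuousOnInterval hab
    obtain ⟨C, hC⟩ := hf1.exists_bound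
    obtain ⟨D, hD⟩ := hg1.exists_bound
    refine squeeze_zero' (Filter.Eventually.of_forall fun I =>
      Finset.sum_nonneg fun i _ => dist_nonneg) (Filter.eventually_inf_principal.2
        (Filter.Eventually.of_forall fun I hI => ?_))
      (by simpa using ((Filter.Tendsto.const_mul (‖B‖ * D) hf1).add
        (Filter.Tendsto.const_mul (‖B‖ * C) hg1)))
    rw [Finset.mul_sum, Finset.mul_sum, ← Finset.sum_add_distrib]
    refine Finset.sum_le_sum fun i hi => ?_
    obtain ⟨h1, h2⟩ := hI.1 i hi
    set x := (I.2 i).1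
    set y := (I.2 i).2
    have e : B (f x) (g x) - B (f y) (g y) = B (f x - f y) (g x) + B (f y) (g x - g y) := by
      simp only [map_sub, sub_apply]
      abel
    rw [dist_eq_norm, e, dist_eq_norm, dist_eq_norm]
    refine (norm_add_le _ _).trans (add_le_add ?_ ?_)
    · calc _ ≤ ‖B‖ * ‖f x - f y‖ * ‖g x‖ := B.le_opNorm₂ _ _
        _ ≤ ‖B‖ * ‖f x - f y‖ * D := by gcongr; exact hD x h1
        _ = _ := by ring
    · calc _ ≤ ‖B‖ * ‖f y‖ * ‖g x - g y‖ := B.le_opNorm₂ _ _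
        _ ≤ ‖B‖ * C * ‖g x - g y‖ := by gcongr; exact hC y h2
  · have hf' := hf.intervalIntegrable
    have hg' := hg.intervalIntegrable
    rw [intervalIntegrable_iff_integrableOn_Icc_of_le hab] at hf' hg' ⊢
    obtain ⟨C, hC⟩ := isCompact_Icc.exists_bound_of_continuousOn hfc
    obtain ⟨D, hD⟩ := isCompact_Icc.exists_bound_of_continuousOn hgc
    have hfm := hfc.aestronglyMeasurable measurableSet_Icc (μ := volume)
    have hgm := hgc.aestronglyMeasurable measurableSet_Icc (μ := volume)
    refine Integrable.add ?_ ?_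
    · refine (hf'.norm.const_mul (‖B‖ * D)).mono'
        (B.aestronglyMeasurable_comp₂ hf'.aestronglyMeasurable hgm) ?_
      filter_upwards [ae_restrict_mem measurableSet_Icc] with x hx
      calc _ ≤ ‖B‖ * ‖f' x‖ * ‖g x‖ := B.le_opNorm₂ _ _
        _ ≤ ‖B‖ * ‖f' x‖ * D := by gcongr; exact hD x hx
        _ = _ := by ring
    · refine (hg'.norm.const_mul (‖B‖ * C)).mono'
        (B.aestronglyMeasurable_comp₂ hfm hg'.aestronglyMeasurable) ?_
      filter_upwards [ae_restrict_mem measurableSet_Icc] with x hx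
      calc _ ≤ ‖B‖ * ‖f x‖ * ‖g' x‖ := B.le_opNorm₂ _ _
        _ ≤ ‖B‖ * C * ‖g' x‖ := by gcongr; exact hC x hx
  · filter_upwards [hf.ae_hasDerivAt hab, hg.ae_hasDerivAt hab] with x h1 h2 hx
    have := B.hasFDerivAt_of_bilinear (h1 hx).hasFDerivAt (h2 hx).hasFDerivAt
    convert! this.hasDerivAt using 1
    simp [add_comm]

theorem integral_eq_sub (hab : a ≤ b) (h : IsPrimitiveOn a b f f') :
    ∫ x in Ioo a b, f' x = f b - f a := by
  rw [h.eq_add_integral b (right_mem_Icc.2 hab), intervalIntegral.integral_of_le hab,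
    integral_Ioc_eq_integral_Ioo]
  abel

theorem norm_sub_le (hab : a ≤ b) (h : IsPrimitiveOn a b f f') {x y : ℝ} (hx : x ∈ Icc a b)
    (hy : y ∈ Icc a b) : ‖f x - f y‖ ≤ ∫ t in Ioo a b, ‖f' t‖ := by
  have hi := h.intervalIntegrable
  have hsub : ∀ x ∈ Icc a b, IntervalIntegrable f' volume a x := fun x hx =>
    hi.mono_set (uIcc_subset_uIcc_left (by rwa [uIcc_of_le hab]))
  rw [h.eq_add_integral x hx, h.eq_add_integral y hy, add_sub_add_left_eq_sub,
    intervalIntegral.integral_interval_sub_left (hsub x hx) (hsub y hy)]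
  refine (intervalIntegral.norm_integral_le_integral_norm_uIoc).trans ?_
  rw [← integral_Ioc_eq_integral_Ioo]
  refine setIntegral_mono_set ?_ (Filter.Eventually.of_forall fun _ => norm_nonneg _) ?_
  · rw [intervalIntegrable_iff_integrableOn_Ioc_of_le hab] at hi
    exact hi.norm
  · exact Filter.Eventually.of_forall fun t ht =>
      ⟨(le_min hy.1 hx.1).trans_lt ht.1, ht.2.trans (max_le hy.2 hx.2)⟩

end IsPrimitiveOn

theorem _root_.ContDiff.isPrimitiveOn {a b : ℝ} [CompleteSpace E] {f : ℝ → E}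
    (hf : ContDiff ℝ 1 f) : IsPrimitiveOn a b f (deriv f) := by
  have hc : Continuous (deriv f) := hf.continuous_deriv le_rfl
  refine ⟨hc.intervalIntegrable _ _, fun x _ => ?_⟩
  rw [intervalIntegral.integral_deriv_eq_sub
    (fun x _ => (hf.differentiable (by simp)).differentiableAt) (hc.intervalIntegrable _ _)]
  abel

/-- A square integrable function with square integrable weak derivative agrees almost everywhere
with a primitive of this derivative. -/
theorem HasWeakDeriv.exists_isPrimitiveOn [CompleteSpace E] {a b : ℝ} (hab : a < b) {f g : L2 a b E}
    (h : HasWeakDeriv a b f g) :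
    ∃ r : ℝ → E, IsPrimitiveOn a b r g ∧ f =ᵐ[volume.restrict (Ioo a b)] r := by
  have hgi : IntervalIntegrable g volume a b :=
    (intervalIntegrable_iff_integrableOn_Ioo_of_le hab.le).2 (L2.integrable g)
  have hG : IsPrimitiveOn a b (fun x => ∫ t in a..x, g t) g := ⟨hgi, fun x _ => by simp⟩
  set G : ℝ → E := fun x => ∫ t in a..x, g t with hGdef
  have hGc := hG.continuousOn hab.le
  have hGi : Integrable G (volume.restrict (Ioo a b)) :=
    (hGc.integrableOn_compact isCompact_Icc).mono_set Ioo_subset_Icc_self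
  have hwi : Integrable (fun x => f x - G x) (volume.restrict (Ioo a b)) :=
    (L2.integrable f).sub hGi
  have smul_int : ∀ (w : ℝ → E), Integrable w (volume.restrict (Ioo a b)) → ∀ φ : ℝ → ℝ,
      Continuous φ → HasCompactSupport φ →
      Integrable (fun x => φ x • w x) (volume.restrict (Ioo a b)) := by
    intro w hw φ hφ hc
    obtain ⟨C, hC⟩ := hc.exists_bound_of_continuous hφ
    exact hw.bdd_smul C hφ.aestronglyMeasurable (Filter.Eventually.of_forall hC)
  have hbd : ∀ φ : ℝ → ℝ, tsupport φ ⊆ Ioo a b → φ a = 0 ∧ φ b = 0 := fun φ hs =>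
    ⟨image_eq_zero_of_notMem_tsupport fun h => (hs h).1.false,
      image_eq_zero_of_notMem_tsupport fun h => (hs h).2.false⟩
  -- The difference `f - G` has weak derivative zero; the rest is the du Bois-Reymond lemma, that
  -- such a function is constant.
  have key : ∀ φ : ℝ → ℝ, ContDiff ℝ ∞ φ → HasCompactSupport φ → tsupport φ ⊆ Ioo a b →
      ∫ x in Ioo a b, deriv φ x • (f x - G x) = 0 := by
    intro φ hφ hc hs
    have hd : Continuous (deriv φ) := hφ.continuous_deriv (by simp)
    have hp := ((hφ.of_le (by simp)).isPrimitiveOn).bilin hab.le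
      (ContinuousLinearMap.lsmul ℝ ℝ) hG
    have hI := hp.integral_eq_sub hab.le
    obtain ⟨ha, hb⟩ := hbd φ hs
    simp only [ContinuousLinearMap.lsmul_apply, ha, hb, zero_smul, sub_zero] at hI
    rw [integral_add (smul_int _ hGi _ hd hc.deriv)
      (smul_int _ (L2.integrable g) _ hφ.continuous hc)] at hI
    simp only [smul_sub]
    rw [integral_sub (smul_int _ (L2.integrable f) _ hd hc.deriv) (smul_int _ hGi _ hd hc.deriv),
      h φ hφ hc hs, eq_neg_of_add_eq_zero_left hI, sub_self]
  obtain ⟨ψ, hψs, hψ, hψ0, hψ1⟩ : ∃ ψ : ℝ → ℝ, tsupport ψ ⊆ Ioo a b ∧ ContDiff ℝ ∞ ψ ∧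
      HasCompactSupport ψ ∧ ∫ x in Ioo a b, ψ x = 1 := by
    let B : ContDiffBump ((a + b) / 2) := ⟨(b - a) / 8, (b - a) / 4, by linarith, by linarith⟩
    have hs : tsupport (B.normed volume) ⊆ Ioo a b := by
      rw [B.tsupport_normed_eq, Real.closedBall_eq_Icc]
      intro x hx
      have h1 : (a + b) / 2 - (b - a) / 4 ≤ x := hx.1
      have h2 : x ≤ (a + b) / 2 + (b - a) / 4 := hx.2
      constructor <;> linarith
    refine ⟨B.normed volume, hs, B.contDiff_normed, B.hasCompactSupport_normed, ?_⟩
    rw [setIntegral_eq_integral_of_forall_compl_eq_zero, B.integral_normed]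
    exact fun x hx => image_eq_zero_of_notMem_tsupport fun h => hx (hs h)
  set c : E := ∫ x in Ioo a b, ψ x • (f x - G x) with hc_def
  have hae : ∀ᵐ x, x ∈ Ioo a b → f x - G x - c = 0 := by
    refine isOpen_Ioo.ae_eq_zero_of_integral_contDiff_smul_eq_zero
      (IntegrableOn.locallyIntegrableOn (hwi.sub (integrable_const c))) fun χ hχ hχc hχs => ?_
    rw [← setIntegral_eq_integral_of_forall_compl_eq_zero (s := Ioo a b)
      (fun x hx => by rw [image_eq_zero_of_notMem_tsupport (fun h => hx (hχs h)), zero_smul])]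
    set m : ℝ := ∫ x in Ioo a b, χ x with hm
    -- Subtracting `m * ψ` makes the integral vanish, so the primitive `Z` of `ζ` is again a test
    -- function. Testing with `Z` gives `∫ χ (f - G) = m ∫ ψ (f - G) = m c`.
    let ζ : ℝ → ℝ := fun x => χ x - m * ψ x
    have hζ : ContDiff ℝ ∞ ζ := hχ.sub (contDiff_const.mul hψ)
    have hζs : tsupport ζ ⊆ tsupport χ ∪ tsupport ψ := by
      refine closure_minimal (fun x hx => ?_) ((isClosed_tsupport _).union (isClosed_tsupport _))
      by_contra hn
      simp only [mem_union, not_or] at hn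
      apply hx
      simp [ζ, image_eq_zero_of_notMem_tsupport hn.1, image_eq_zero_of_notMem_tsupport hn.2]
    have hχi : Integrable χ (volume.restrict (Ioo a b)) :=
      (hχ.continuous.integrable_of_hasCompactSupport hχc).restrict
    have hψi : Integrable ψ (volume.restrict (Ioo a b)) :=
      (hψ.continuous.integrable_of_hasCompactSupport hψ0).restrict
    have hζ0 : ∫ x in Ioo a b, ζ x = 0 := by
      rw [integral_sub hχi (hψi.const_mul m), integral_const_mul, hψ1, mul_one, sub_self]
    obtain ⟨a', b', ha', hb', hK⟩ : ∃ a' b', a < a' ∧ b' < b ∧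
        tsupport χ ∪ tsupport ψ ⊆ Icc a' b' := by
      have hcK : IsCompact (tsupport χ ∪ tsupport ψ) := hχc.isCompact.union hψ0.isCompact
      have hne : (tsupport χ ∪ tsupport ψ).Nonempty := by
        by_contra hn
        rw [not_nonempty_iff_eq_empty, union_empty_iff] at hn
        have : ψ = 0 := tsupport_eq_empty_iff.1 hn.2
        simp [this] at hψ1
      have hKs : tsupport χ ∪ tsupport ψ ⊆ Ioo a b := union_subset hχs hψs
      exact ⟨sInf _, sSup _, (hKs (hcK.sInf_mem hne)).1, (hKs (hcK.sSup_mem hne)).2, fun x hx =>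
          ⟨csInf_le hcK.bddBelow hx, le_csSup hcK.bddAbove hx⟩⟩
    have hζ' : ∀ x, x ∉ Icc a' b' → ζ x = 0 := fun x hx =>
      image_eq_zero_of_notMem_tsupport fun h => hx (hK (hζs h))
    let Z : ℝ → ℝ := fun x => ∫ t in a..x, ζ t
    have hZd : ∀ x, HasDerivAt Z (ζ x) x := fun x =>
      intervalIntegral.integral_hasDerivAt_right (hζ.continuous.intervalIntegrable _ _)
        (hζ.continuous.stronglyMeasurableAtFilter _ _) hζ.continuous.continuousAt
    have hZder : deriv Z = ζ := funext fun x => (hZd x).deriv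
    have hZ : ContDiff ℝ ∞ Z := by
      rw [contDiff_infty_iff_deriv]
      exact ⟨fun x => (hZd x).differentiableAt, hZder ▸ hζ⟩
    have hZl : ∀ x, x < a' → Z x = 0 := by
      intro x hx
      refine (intervalIntegral.integral_congr (g := fun _ => 0) fun t ht => ?_).trans (by simp)
      exact hζ' t fun h => by
        have := ht.2
        have h1 := h.1
        rcases max_choice a x with e | e <;> rw [e] at this <;> linarith
    have hZb : Z b = 0 := by
      simp only [Z]
      rw [intervalIntegral.integral_of_le hab.le, integral_Ioc_eq_integral_Ioo, hζ0]
    have hZr : ∀ x, b' < x → Z x = 0 := by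
      intro x hx
      have e : Z x = Z b + ∫ t in b..x, ζ t :=
        (intervalIntegral.integral_add_adjacent_intervals (hζ.continuous.intervalIntegrable _ _)
          (hζ.continuous.intervalIntegrable _ _)).symm
      rw [e, hZb, zero_add]
      refine (intervalIntegral.integral_congr (g := fun _ => 0) fun t ht => ?_).trans (by simp)
      exact hζ' t fun h => by
        have := ht.1
        have h1 := h.2
        rcases min_choice b x with e | e <;> rw [e] at this <;> linarith
    have hZs : tsupport Z ⊆ Icc a' b' := by
      refine closure_minimal (fun x hx => ?_) isClosed_Icc
      by_contra hn
      rw [mem_Icc, not_and_or, not_le, not_le] at hn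
      exact hx (hn.elim (hZl x) (hZr x))
    have hk := key Z hZ (isCompact_Icc.of_isClosed_subset (isClosed_tsupport _) hZs)
      (hZs.trans fun x hx => ⟨ha'.trans_le hx.1, hx.2.trans_lt hb'⟩)
    rw [hZder] at hk
    simp only [ζ, sub_smul, mul_smul] at hk
    have hmi : Integrable (fun x => m • ψ x • (f x - G x)) (volume.restrict (Ioo a b)) :=
      (smul_int _ hwi _ hψ.continuous hψ0).smul m
    rw [integral_sub (smul_int _ hwi _ hχ.continuous hχc) hmi, integral_smul, sub_eq_zero] at hk
    simp only [smul_sub _ _ c]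
    rw [integral_sub (smul_int _ hwi _ hχ.continuous hχc) (hχi.smul_const c), hk,
      integral_smul_const, sub_self]
  refine ⟨fun x => c + G x, ⟨hgi, fun x _ => by simp [hGdef]⟩, ?_⟩
  rw [Filter.EventuallyEq, ae_restrict_iff' measurableSet_Ioo]
  filter_upwards [hae] with x hx hxI
  rw [eq_comm, ← sub_eq_zero, ← neg_eq_zero, ← hx hxI]
  abel

end Primitive

/-! ### Integration by parts, trace and Poincaré inequalities -/

section Inequalities

theorem IsPrimitiveOn.integral_le {a b : ℝ} (hab : a ≤ b) {P P' : ℝ → ℝ}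
    (h : IsPrimitiveOn a b P P') {c D : ℝ} (hc : c ∈ Icc a b) (hD : ∫ x in Ioo a b, ‖P' x‖ ≤ D) :
    ∫ x in Ioo a b, P x ≤ (b - a) * (P c + D) := by
  have hi : IntegrableOn P (Ioo a b) :=
    ((h.continuousOn hab).integrableOn_compact isCompact_Icc).mono_set Ioo_subset_Icc_self
  calc ∫ x in Ioo a b, P x ≤ ∫ x in Ioo a b, (P c + D) := by
        refine setIntegral_mono_on hi (integrable_const _) measurableSet_Ioo fun x hx => ?_
        have := (le_abs_self _).trans (h.norm_sub_le hab (Ioo_subset_Icc_self hx) hc)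
        linarith
    _ = _ := by simp [hab]

theorem IsPrimitiveOn.le_integral {a b : ℝ} (hab : a ≤ b) {P P' : ℝ → ℝ}
    (h : IsPrimitiveOn a b P P') {c D : ℝ} (hc : c ∈ Icc a b) (hD : ∫ x in Ioo a b, ‖P' x‖ ≤ D) :
    (b - a) * P c ≤ (∫ x in Ioo a b, P x) + (b - a) * D := by
  have hi : IntegrableOn P (Ioo a b) :=
    ((h.continuousOn hab).integrableOn_compact isCompact_Icc).mono_set Ioo_subset_Icc_self
  have : ∫ x in Ioo a b, (P c - D) ≤ ∫ x in Ioo a b, P x := by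
    refine setIntegral_mono_on (integrable_const _) hi measurableSet_Ioo fun x hx => ?_
    have := (le_abs_self _).trans (h.norm_sub_le hab hc (Ioo_subset_Icc_self hx))
    linarith
  simp [hab] at this
  linarith

theorem HasTrace.eq_apply {E : Type*} [NormedAddCommGroup E] {a b c : ℝ} (hab : a < b)
    (hc : c ∈ Icc a b) {f : L2 a b E} {t : E} (h : HasTrace a b f c t) {r : ℝ → E}
    (hr : ContinuousOn r (Icc a b)) (hfr : f =ᵐ[volume.restrict (Ioo a b)] r) : t = r c :=
  h.unique hab hc ⟨r, hr, hfr, rfl⟩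

theorem HasWeakDeriv.exists_hasTrace {E : Type*} [NormedAddCommGroup E] [NormedSpace ℝ E]
    [CompleteSpace E] {a b : ℝ} (hab : a < b) {f f' : L2 a b E} (h : HasWeakDeriv a b f f')
    (c : ℝ) : ∃ t, HasTrace a b f c t := by
  obtain ⟨r, hr, hfr⟩ := h.exists_isPrimitiveOn hab
  exact ⟨r c, r, hr.continuousOn hab.le, hfr, rfl⟩

theorem L2.integral_norm_mul_norm_le {E F : Type*} [NormedAddCommGroup E] [NormedAddCommGroup F]
    {a b : ℝ} (f : L2 a b E) (g : L2 a b F) :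
    ∫ x in Ioo a b, ‖f x‖ * ‖g x‖ ≤ ‖f‖ * ‖g‖ := by
  have h := real_inner_le_norm ((Lp.memLp f).norm.toLp _) ((Lp.memLp g).norm.toLp _)
  rw [Lp.norm_toLp, Lp.norm_toLp, eLpNorm_norm, eLpNorm_norm, L2.inner_def] at h
  refine le_trans (le_of_eq (integral_congr_ae ?_)) h
  filter_upwards [(Lp.memLp f).norm.coeFn_toLp, (Lp.memLp g).norm.coeFn_toLp] with x h1 h2
  rw [h1, h2]
  simp [mul_comm]

theorem L2.integrable_norm_mul_norm {E F : Type*} [NormedAddCommGroup E] [NormedAddCommGroup F]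
    {a b : ℝ} (f : L2 a b E) (g : L2 a b F) :
    Integrable (fun x => ‖f x‖ * ‖g x‖) (volume.restrict (Ioo a b)) :=
  (Lp.memLp f).norm.integrable_mul (Lp.memLp g).norm

variable {H : Type*} [NormedAddCommGroup H] [InnerProductSpace ℝ H]

theorem L2.norm_sq_eq_integral {a b : ℝ} (f : L2 a b H) :
    ‖f‖ ^ 2 = ∫ x in Ioo a b, ‖f x‖ ^ 2 := by
  rw [← real_inner_self_eq_norm_sq, L2.inner_def]
  simp only [real_inner_self_eq_norm_sq]

theorem L2.norm_sq_eq_integral_of_ae_eq {a b : ℝ} {f : L2 a b H} {r : ℝ → H}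
    (h : f =ᵐ[volume.restrict (Ioo a b)] r) : ‖f‖ ^ 2 = ∫ x in Ioo a b, ‖r x‖ ^ 2 := by
  rw [L2.norm_sq_eq_integral]
  exact integral_congr_ae (h.mono fun x hx => by simp only [hx])

variable [CompleteSpace H] {a b : ℝ}

theorem IsPrimitiveOn.real_inner (hab : a ≤ b) {f f' g g' : ℝ → H} (hf : IsPrimitiveOn a b f f')
    (hg : IsPrimitiveOn a b g g') :
    IsPrimitiveOn a b (fun x => inner ℝ (f x) (g x))
      (fun x => inner ℝ (f' x) (g x) + inner ℝ (f x) (g' x)) :=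
  hf.bilin hab ((innerₗ H).mkContinuous₂ 1 fun x y => by
    simpa using norm_inner_le_norm (𝕜 := ℝ) x y) hg

theorem IsPrimitiveOn.norm_sq (hab : a ≤ b) {f f' : ℝ → H} (hf : IsPrimitiveOn a b f f') :
    IsPrimitiveOn a b (fun x => ‖f x‖ ^ 2) (fun x => 2 * inner ℝ (f' x) (f x)) := by
  have h := hf.real_inner hab hf
  simp only [real_inner_self_eq_norm_sq] at h
  have e : (fun x => inner ℝ (f' x) (f x) + inner ℝ (f x) (f' x))
      = fun x => 2 * inner ℝ (f' x) (f x) := by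
    funext x
    rw [real_inner_comm (f' x) (f x), two_mul]
  rwa [e] at h

/-- Integration by parts. -/
theorem HasWeakDeriv.inner_add_inner (hab : a < b) {f f' g g' : L2 a b H}
    (hf : HasWeakDeriv a b f f') (hg : HasWeakDeriv a b g g') {fa fb ga gb : H}
    (hfa : HasTrace a b f a fa) (hfb : HasTrace a b f b fb)
    (hga : HasTrace a b g a ga) (hgb : HasTrace a b g b gb) :
    inner ℝ f' g + inner ℝ f g' = inner ℝ fb gb - inner ℝ fa ga := by
  obtain ⟨r, hr, hfr⟩ := hf.exists_isPrimitiveOn hab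
  obtain ⟨q, hq, hgq⟩ := hg.exists_isPrimitiveOn hab
  have hrc := hr.continuousOn hab.le
  have hqc := hq.continuousOn hab.le
  rw [hfa.eq_apply hab (left_mem_Icc.2 hab.le) hrc hfr,
    hfb.eq_apply hab (right_mem_Icc.2 hab.le) hrc hfr,
    hga.eq_apply hab (left_mem_Icc.2 hab.le) hqc hgq,
    hgb.eq_apply hab (right_mem_Icc.2 hab.le) hqc hgq,
    ← (hr.real_inner hab.le hq).integral_eq_sub hab.le, L2.inner_def, L2.inner_def,
    ← integral_add (L2.integrable_inner f' g) (L2.integrable_inner f g')]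
  refine integral_congr_ae ?_
  filter_upwards [hfr, hgq] with x h1 h2
  rw [h1, h2]

/-- Only the component of `f'` along `f` changes `‖f‖²`. Replacing `f'` by `h` discards a skew part
such as `iτλf`, which makes the bounds independent of the frequency. -/
theorem HasWeakDeriv.exists_norm_sq_isPrimitiveOn (hab : a < b) {f f' h : L2 a b H}
    (hf : HasWeakDeriv a b f f')
    (hh : ∀ᵐ x ∂volume.restrict (Ioo a b), inner ℝ (f' x) (f x) = inner ℝ (h x) (f x)) :
    ∃ (r : ℝ → H) (p' : ℝ → ℝ), ContinuousOn r (Icc a b) ∧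
      f =ᵐ[volume.restrict (Ioo a b)] r ∧ IsPrimitiveOn a b (fun x => ‖r x‖ ^ 2) p' ∧
      ∫ x in Ioo a b, ‖p' x‖ ≤ 2 * (‖h‖ * ‖f‖) := by
  obtain ⟨r, hr, hfr⟩ := hf.exists_isPrimitiveOn hab
  refine ⟨r, _, hr.continuousOn hab.le, hfr, hr.norm_sq hab.le, ?_⟩
  refine le_trans ?_ (mul_le_mul_of_nonneg_left (L2.integral_norm_mul_norm_le h f) zero_le_two)
  rw [← integral_const_mul]
  refine integral_mono_of_nonneg (Filter.Eventually.of_forall fun _ => norm_nonneg _)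
    ((L2.integrable_norm_mul_norm h f).const_mul 2) ?_
  filter_upwards [hh, hfr] with x h1 h2
  rw [← h2, h1, norm_mul, Real.norm_ofNat]
  exact mul_le_mul_of_nonneg_left (norm_inner_le_norm _ _) zero_le_two

section

variable {f f' h : L2 a b H} {c d : ℝ} {s t : H}

theorem HasWeakDeriv.norm_sq_trace_le_add (hab : a < b) (hf : HasWeakDeriv a b f f')
    (hh : ∀ᵐ x ∂volume.restrict (Ioo a b), inner ℝ (f' x) (f x) = inner ℝ (h x) (f x))
    (hc : c ∈ Icc a b) (hs : HasTrace a b f c s) (hd : d ∈ Icc a b) (ht : HasTrace a b f d t) :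
    ‖t‖ ^ 2 ≤ ‖s‖ ^ 2 + 2 * (‖h‖ * ‖f‖) := by
  obtain ⟨r, p', hrc, hfr, hp, hle⟩ := hf.exists_norm_sq_isPrimitiveOn hab hh
  rw [hs.eq_apply hab hc hrc hfr, ht.eq_apply hab hd hrc hfr]
  have := (le_abs_self _).trans (hp.norm_sub_le hab.le hd hc)
  linarith

theorem HasWeakDeriv.norm_sq_le (hab : a < b) (hf : HasWeakDeriv a b f f')
    (hh : ∀ᵐ x ∂volume.restrict (Ioo a b), inner ℝ (f' x) (f x) = inner ℝ (h x) (f x))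
    (hc : c ∈ Icc a b) (hs : HasTrace a b f c s) :
    ‖f‖ ^ 2 ≤ (b - a) * (‖s‖ ^ 2 + 2 * (‖h‖ * ‖f‖)) := by
  obtain ⟨r, p', hrc, hfr, hp, hle⟩ := hf.exists_norm_sq_isPrimitiveOn hab hh
  rw [hs.eq_apply hab hc hrc hfr, L2.norm_sq_eq_integral_of_ae_eq hfr]
  exact hp.integral_le hab.le hc hle

/-- The one-dimensional trace inequality. -/
theorem HasWeakDeriv.norm_sq_trace_le (hab : a < b) (hf : HasWeakDeriv a b f f')
    (hc : c ∈ Icc a b) (hs : HasTrace a b f c s) :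
    (b - a) * ‖s‖ ^ 2 ≤ ‖f‖ ^ 2 + (b - a) * (2 * (‖f'‖ * ‖f‖)) := by
  obtain ⟨r, p', hrc, hfr, hp, hle⟩ :=
    hf.exists_norm_sq_isPrimitiveOn hab (h := f') (Filter.Eventually.of_forall fun _ => rfl)
  rw [hs.eq_apply hab hc hrc hfr, L2.norm_sq_eq_integral_of_ae_eq hfr]
  exact hp.le_integral hab.le hc hle

end

/-- The Poincaré inequality for functions of mean value zero. -/
theorem HasWeakDeriv.norm_le_of_integral_eq_zero (hab : a < b) {f f' : L2 a b H}
    (hf : HasWeakDeriv a b f f') (h0 : ∫ x in Ioo a b, f x = 0) :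
    ‖f‖ ≤ (b - a) * ‖f'‖ := by
  obtain ⟨r, hr, hfr⟩ := hf.exists_isPrimitiveOn hab
  have hba : 0 < b - a := sub_pos.2 hab
  have hrc := hr.continuousOn hab.le
  have hri : IntegrableOn r (Ioo a b) :=
    (hrc.integrableOn_compact isCompact_Icc).mono_set Ioo_subset_Icc_self
  rw [integral_congr_ae hfr] at h0
  set N := ∫ x in Ioo a b, ‖f' x‖ with hN
  have hN0 : 0 ≤ N := integral_nonneg fun _ => norm_nonneg _
  have hN1 : N ^ 2 ≤ (b - a) * ‖f'‖ ^ 2 := by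
    have hm : MemLp (fun _ : ℝ => (1 : ℝ)) 2 (volume.restrict (Ioo a b)) := memLp_const 1
    have h1 := L2.integral_norm_mul_norm_le f' (hm.toLp _)
    have h2 : ∫ x in Ioo a b, ‖f' x‖ * ‖(hm.toLp _ : L2 a b ℝ) x‖ = N := by
      refine integral_congr_ae ?_
      filter_upwards [hm.coeFn_toLp] with x hx
      rw [hx, norm_one, mul_one]
    have h3 : ‖(hm.toLp _ : L2 a b ℝ)‖ ^ 2 = b - a := by
      rw [L2.norm_sq_eq_integral_of_ae_eq hm.coeFn_toLp]
      simp [hab.le]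
    rw [h2] at h1
    calc N ^ 2 ≤ (‖f'‖ * ‖(hm.toLp _ : L2 a b ℝ)‖) ^ 2 := by gcongr
      _ = _ := by rw [mul_pow, h3, mul_comm]
  -- Since `r` has mean zero, `r x` is the average over `y` of `r x - r y`.
  have hpt : ∀ x ∈ Ioo a b, ‖r x‖ ≤ N := by
    intro x hx
    have h1 : ∫ y in Ioo a b, (r x - r y) = (b - a) • r x := by
      rw [integral_sub (integrable_const _) hri, h0, sub_zero]
      simp [hab.le]
    have h2 : ‖∫ y in Ioo a b, (r x - r y)‖ ≤ N * volume.real (Ioo a b) :=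
      norm_setIntegral_le_of_norm_le_const (by simp) fun y hy =>
        hr.norm_sub_le hab.le (Ioo_subset_Icc_self hx) (Ioo_subset_Icc_self hy)
    rw [h1, norm_smul, Real.norm_of_nonneg hba.le, Real.volume_real_Ioo_of_le hab.le,
      mul_comm] at h2
    exact le_of_mul_le_mul_right h2 hba
  have hsq : ‖f‖ ^ 2 ≤ ((b - a) * ‖f'‖) ^ 2 := by
    rw [L2.norm_sq_eq_integral_of_ae_eq hfr]
    calc ∫ x in Ioo a b, ‖r x‖ ^ 2 ≤ ∫ x in Ioo a b, N ^ 2 := by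
          refine setIntegral_mono_on ?_ (integrable_const _) measurableSet_Ioo fun x hx => ?_
          · exact ((hrc.norm.pow 2).integrableOn_compact isCompact_Icc).mono_set
              Ioo_subset_Icc_self
          · have := hpt x hx
            gcongr
      _ = (b - a) * N ^ 2 := by simp [hab.le]
      _ ≤ (b - a) * ((b - a) * ‖f'‖ ^ 2) := by gcongr
      _ = _ := by ring
  exact (pow_le_pow_iff_left₀ (norm_nonneg _) (by positivity) two_ne_zero).1 hsq

/-- For a solution of the wave equation at frequency `l`, written as a first order system, the
energy is controlled by the energy density at one point and the data. -/
theorem wave_norm_sq_le (hab : a < b) {k l : ℝ} {f f' g g' h₁ h₂ : L2 a b ℂ}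
    (hf : HasWeakDeriv a b f f') (hg : HasWeakDeriv a b g g')
    (h1 : (k : ℂ) • f' = (Complex.I * l) • g - h₁) (h2 : g' = (Complex.I * l) • f - h₂)
    {c : ℝ} {s t : ℂ} (hc : c ∈ Icc a b) (hs : HasTrace a b f c s) (ht : HasTrace a b g c t) :
    k * ‖f‖ ^ 2 + ‖g‖ ^ 2
      ≤ (b - a) * (k * ‖s‖ ^ 2 + ‖t‖ ^ 2 + 2 * (‖h₁‖ * ‖f‖ + ‖h₂‖ * ‖g‖)) := by
  obtain ⟨r, hr, hfr⟩ := hf.exists_isPrimitiveOn hab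
  obtain ⟨q, hq, hgq⟩ := hg.exists_isPrimitiveOn hab
  have hrc := hr.continuousOn hab.le
  have hqc := hq.continuousOn hab.le
  have hr2 := hr.norm_sq hab.le
  have hq2 := hq.norm_sq hab.le
  have hI : ∀ u : ℝ → ℂ, ContinuousOn u (Icc a b) → IntegrableOn (fun x => ‖u x‖ ^ 2) (Ioo a b) :=
    fun u hu => ((hu.norm.pow 2).integrableOn_compact isCompact_Icc).mono_set Ioo_subset_Icc_self
  rw [hs.eq_apply hab hc hrc hfr, ht.eq_apply hab hc hqc hgq,
    L2.norm_sq_eq_integral_of_ae_eq hfr, L2.norm_sq_eq_integral_of_ae_eq hgq,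
    ← integral_const_mul, ← integral_add ((hI r hrc).const_mul k) (hI q hqc)]
  have hP : IsPrimitiveOn a b (fun x => k * ‖r x‖ ^ 2 + ‖q x‖ ^ 2)
      (fun x => k * (2 * inner ℝ (f' x) (r x)) + 2 * inner ℝ (g' x) (q x)) := by
    refine ⟨(hr2.intervalIntegrable.const_mul k).add hq2.intervalIntegrable, fun x hx => ?_⟩
    have hsub : ∀ {u : ℝ → ℝ}, IntervalIntegrable u volume a b → IntervalIntegrable u volume a x :=
      fun h => h.mono_set (uIcc_subset_uIcc_left (by rwa [uIcc_of_le hab.le]))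
    rw [intervalIntegral.integral_add (hsub (hr2.intervalIntegrable.const_mul k))
      (hsub hq2.intervalIntegrable), intervalIntegral.integral_const_mul,
      hr2.eq_add_integral x hx, hq2.eq_add_integral x hx]
    ring
  refine hP.integral_le hab.le hc ?_
  have hle := add_le_add (L2.integral_norm_mul_norm_le h₁ f) (L2.integral_norm_mul_norm_le h₂ g)
  rw [← integral_add (L2.integrable_norm_mul_norm h₁ f) (L2.integrable_norm_mul_norm h₂ g)] at hle
  refine le_trans ?_ (mul_le_mul_of_nonneg_left hle zero_le_two)
  rw [← integral_const_mul]
  refine integral_mono_of_nonneg (Filter.Eventually.of_forall fun _ => norm_nonneg _)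
    (((L2.integrable_norm_mul_norm h₁ f).add (L2.integrable_norm_mul_norm h₂ g)).const_mul 2) ?_
  have e1 : ∀ᵐ x ∂volume.restrict (Ioo a b), (k : ℂ) * f' x = Complex.I * l * g x - h₁ x := by
    have := Lp.coeFn_smul (k : ℂ) f'
    rw [h1] at this
    filter_upwards [this, Lp.coeFn_sub ((Complex.I * l) • g) h₁,
      Lp.coeFn_smul (Complex.I * (l : ℂ)) g] with x k1 k2 k3
    rw [← smul_eq_mul, ← Pi.smul_apply, ← k1, k2, Pi.sub_apply, k3, Pi.smul_apply, smul_eq_mul]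
  have e2 : ∀ᵐ x ∂volume.restrict (Ioo a b), g' x = Complex.I * l * f x - h₂ x := by
    rw [h2]
    filter_upwards [Lp.coeFn_sub ((Complex.I * l) • f) h₂,
      Lp.coeFn_smul (Complex.I * (l : ℂ)) f] with x k2 k3
    rw [k2, Pi.sub_apply, k3, Pi.smul_apply, smul_eq_mul]
  filter_upwards [hfr, hgq, e1, e2] with x h1 h2 h3 h4
  -- Conservation of energy density: `⟨ilg, f⟩ + ⟨ilf, g⟩ = 0`, so only the data survive.
  have e : k * (2 * inner ℝ (f' x) (f x)) + 2 * inner ℝ (g' x) (g x)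
      = -(2 * (inner ℝ (h₁ x) (f x) + inner ℝ (h₂ x) (g x))) := by
    have h5 : k * inner ℝ (f' x) (f x) = inner ℝ ((k : ℂ) * f' x) (f x) := by
      simp [Complex.inner]
      ring
    rw [mul_left_comm, h5, h3, h4]
    simp [Complex.inner]
    ring
  rw [← h1, ← h2, e, norm_neg, norm_mul, Real.norm_ofNat]
  refine mul_le_mul_of_nonneg_left ?_ zero_le_two
  exact (norm_add_le _ _).trans (add_le_add (norm_inner_le_norm _ _) (norm_inner_le_norm _ _))

end Inequalities

/-! ### The derivative as an operator and the energy norm -/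

section Energy

theorem L2.re_inner_eq {a b : ℝ} (f g : L2 a b ℂ) : (inner ℂ f g : ℂ).re = inner ℝ f g := by
  rw [L2.inner_def, L2.inner_def]
  exact (integral_re (L2.integrable_inner (𝕜 := ℂ) f g)).symm

/-- The real inner product and the complex scalars of `E` are not tied together, so skewness on `E`
is assumed. The lemma can then be iterated from `ℂ` to `L²` and to `L²` with values in `L²`. -/
theorem L2.inner_I_smul_self {E : Type*} [NormedAddCommGroup E] [InnerProductSpace ℝ E]
    [NormedSpace ℂ E] (hE : ∀ (l : ℝ) (x : E), inner ℝ ((Complex.I * (l : ℂ)) • x) x = 0)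
    {a b : ℝ} (l : ℝ) (f : L2 a b E) : inner ℝ ((Complex.I * (l : ℂ)) • f) f = 0 := by
  rw [L2.inner_def]
  refine integral_eq_zero_of_ae ?_
  filter_upwards [Lp.coeFn_smul (Complex.I * (l : ℂ)) f] with x hx
  rw [hx, Pi.smul_apply, hE, Pi.zero_apply]

theorem _root_.Complex.inner_I_smul_self (l : ℝ) (x : ℂ) :
    inner ℝ ((Complex.I * (l : ℂ)) • x) x = 0 := by
  simp [Complex.inner]
  ring

theorem L2.ofReal_smul {a b : ℝ} (k : ℝ) (f : L2 a b ℂ) : (k : ℂ) • f = k • f := by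
  refine Lp.ext ?_
  filter_upwards [Lp.coeFn_smul (k : ℂ) f, Lp.coeFn_smul k f] with x h1 h2
  rw [h1, h2]
  simp

variable {a b : ℝ}

/-- The weak derivative as a continuous operator on `H¹_*(a,b)`. -/
def H1star.dxCLM (a b : ℝ) : H1star a b →L[ℂ] L2 a b ℂ where
  toFun := H1star.dx
  map_add' _ _ := rfl
  map_smul' _ _ := rfl
  cont := (WithLp.prod_continuous_ofLp 2 _ _).snd.comp
    ((continuous_subtype_val (p := fun x => x ∈ H1sub a b)).comp
      (continuous_subtype_val (p := fun x => x ∈ H1starSub a b)))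

/-- The weak derivative of functions with values in `H¹_*(a,b)`. -/
def L2.dx (f : L2 0 1 (H1star a b)) : L2 0 1 (L2 a b ℂ) := (H1star.dxCLM a b).compLp f

theorem L2.coeFn_dx (f : L2 0 1 (H1star a b)) :
    ∀ᵐ ρ ∂volume.restrict (Ioo (0 : ℝ) 1), L2.dx f ρ = (f ρ).dx :=
  (H1star.dxCLM a b).coeFn_compLp f

theorem L2.dx_add (f g : L2 0 1 (H1star a b)) : L2.dx (f + g) = L2.dx f + L2.dx g :=
  ((H1star.dxCLM a b).compLpₗ 2 _).map_add f g

theorem L2.dx_smul (c : ℂ) (f : L2 0 1 (H1star a b)) : L2.dx (c • f) = c • L2.dx f :=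
  ((H1star.dxCLM a b).compLpₗ 2 _).map_smul c f

theorem HasTrace.dx {f : L2 0 1 (H1star a b)} {c : ℝ} {t : H1star a b}
    (h : HasTrace 0 1 f c t) : HasTrace 0 1 (L2.dx f) c t.dx := by
  obtain ⟨r, hr, hfr, rfl⟩ := h
  refine ⟨fun ρ => (r ρ).dx, (H1star.dxCLM a b).continuous.comp_continuousOn hr, ?_, rfl⟩
  filter_upwards [L2.coeFn_dx f, hfr] with ρ h1 h2
  rw [h1, h2]

/-- The energy sees `η` only through `η_x`, so the transport equation is moved to `L²`-valued
functions; a continuous linear map commutes with the integrals against test functions. -/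
theorem HasWeakDeriv.dx {f g : L2 0 1 (H1star a b)} (h : HasWeakDeriv 0 1 f g) :
    HasWeakDeriv 0 1 (L2.dx f) (L2.dx g) := by
  have key : ∀ (φ : ℝ → ℝ) (f : L2 0 1 (H1star a b)), Continuous φ → HasCompactSupport φ →
      ∫ ρ in Ioo (0 : ℝ) 1, φ ρ • L2.dx f ρ
        = H1star.dxCLM a b (∫ ρ in Ioo (0 : ℝ) 1, φ ρ • f ρ) := by
    intro φ f hφ hc
    rw [← ContinuousLinearMap.integral_comp_comm _ (L2.integrable_smul f hφ hc)]
    refine integral_congr_ae ?_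
    filter_upwards [L2.coeFn_dx f] with ρ h1
    rw [h1, ← Complex.coe_smul, map_smul, L2.ofReal_smul]
    rfl
  intro φ hφ hc hs
  rw [key _ _ (hφ.continuous_deriv (by simp)) hc.deriv, key _ _ hφ.continuous hc, h φ hφ hc hs,
    map_neg]

variable {p : Params}

theorem re_energyInner (U V : Energy p) : (energyInner U V).re =
    p.κ₁ * inner ℝ U.1.left.dx V.1.left.dx + p.κ₂ * inner ℝ U.1.mid.dx V.1.mid.dx
      + p.κ₃ * inner ℝ U.1.right.dx V.1.right.dx + inner ℝ U.2.1.1 V.2.1.1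
      + inner ℝ (U.2.1.2.1 : L2 p.α p.β ℂ) (V.2.1.2.1 : L2 p.α p.β ℂ)
      + inner ℝ U.2.1.2.2 V.2.1.2.2 + p.τ * |p.δ₂| * inner ℝ (L2.dx U.2.2) (L2.dx V.2.2) := by
  have e : (∫ ρ in Ioo (0 : ℝ) 1, (inner ℂ (V.2.2 ρ).dx (U.2.2 ρ).dx : ℂ)).re
      = inner ℝ (L2.dx V.2.2) (L2.dx U.2.2) := by
    have hi : Integrable (fun ρ => (inner ℂ (V.2.2 ρ).dx (U.2.2 ρ).dx : ℂ))
        (volume.restrict (Ioo (0 : ℝ) 1)) := by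
      refine (L2.integrable_inner (𝕜 := ℂ) (L2.dx V.2.2) (L2.dx U.2.2)).congr ?_
      filter_upwards [L2.coeFn_dx V.2.2, L2.coeFn_dx U.2.2] with ρ h1 h2
      rw [h1, h2]
    rw [L2.inner_def]
    refine (integral_re hi).symm.trans (integral_congr_ae ?_)
    filter_upwards [L2.coeFn_dx V.2.2, L2.coeFn_dx U.2.2] with ρ h1 h2
    rw [h1, h2]
    exact L2.re_inner_eq _ _
  have h2 : (p.τ : ℂ) * (|p.δ₂| : ℝ) = ((p.τ * |p.δ₂| : ℝ) : ℂ) := by push_cast; rfl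
  simp only [energyInner, h2, Complex.add_re, Complex.re_ofReal_mul, e, L2.re_inner_eq]
  simp only [real_inner_comm]

theorem re_energyInner_self (U : Energy p) : (energyInner U U).re =
    p.κ₁ * ‖U.1.left.dx‖ ^ 2 + p.κ₂ * ‖U.1.mid.dx‖ ^ 2
      + p.κ₃ * ‖U.1.right.dx‖ ^ 2 + ‖U.2.1.1‖ ^ 2
      + ‖(U.2.1.2.1 : L2 p.α p.β ℂ)‖ ^ 2
      + ‖U.2.1.2.2‖ ^ 2 + p.τ * |p.δ₂| * ‖L2.dx U.2.2‖ ^ 2 := by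
  simp only [re_energyInner, real_inner_self_eq_norm_sq]

theorem energyNorm_sq (hκ₁ : 0 < p.κ₁) (hκ₂ : 0 < p.κ₂) (hκ₃ : 0 < p.κ₃) (hτ : 0 < p.τ)
    (U : Energy p) : energyNorm U ^ 2 =
    p.κ₁ * ‖U.1.left.dx‖ ^ 2 + p.κ₂ * ‖U.1.mid.dx‖ ^ 2
      + p.κ₃ * ‖U.1.right.dx‖ ^ 2 + ‖U.2.1.1‖ ^ 2
      + ‖(U.2.1.2.1 : L2 p.α p.β ℂ)‖ ^ 2
      + ‖U.2.1.2.2‖ ^ 2 + p.τ * |p.δ₂| * ‖L2.dx U.2.2‖ ^ 2 := by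
  rw [energyNorm, Real.sq_sqrt, re_energyInner_self]
  rw [re_energyInner_self]
  positivity

end Energy

/-! ### Energy estimates for the resolvent equation -/

/-- Norms and traces of the components of a solution `U` of `(iλ - 𝓐₂) U = F` with `‖U‖ = N` and
`‖F‖ = Φ`, with the relations that follow from the equations. Here `F = (f, g, h)`, `q` is the flux
`κ₂ v + δ₁ z + δ₂ η(·,1)`, and `Sα = |u_x(α)|`, `Sβ = |w_x(β)|`, `Zα = |z(α)|`, `Zβ = |z(β)|`. -/
structure ResolventBounds (p : Params) (l N Φ : ℝ) where
  (ux vx wx y z ϕ η f₁ f₂ f₃ g₁ g₂ g₃ h zx qx qxx η₁ Sα Sβ Zα Zβ : ℝ)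
  N_nonneg : 0 ≤ N
  Φ_nonneg : 0 ≤ Φ
  vx_nonneg : 0 ≤ vx
  z_nonneg : 0 ≤ z
  ϕ_nonneg : 0 ≤ ϕ
  η_nonneg : 0 ≤ η
  f₁_nonneg : 0 ≤ f₁
  f₂_nonneg : 0 ≤ f₂
  f₃_nonneg : 0 ≤ f₃
  g₁_nonneg : 0 ≤ g₁
  g₂_nonneg : 0 ≤ g₂
  g₃_nonneg : 0 ≤ g₃
  zx_nonneg : 0 ≤ zx
  qx_nonneg : 0 ≤ qx
  qxx_nonneg : 0 ≤ qxx
  η₁_nonneg : 0 ≤ η₁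
  Sα_nonneg : 0 ≤ Sα
  Sβ_nonneg : 0 ≤ Sβ
  Zα_nonneg : 0 ≤ Zα
  Zβ_nonneg : 0 ≤ Zβ
  N_sq : N ^ 2 = p.κ₁ * ux ^ 2 + p.κ₂ * vx ^ 2 + p.κ₃ * wx ^ 2 + y ^ 2 + z ^ 2 + ϕ ^ 2
    + p.τ * |p.δ₂| * η ^ 2
  Φ_sq : Φ ^ 2 = p.κ₁ * f₁ ^ 2 + p.κ₂ * f₂ ^ 2 + p.κ₃ * f₃ ^ 2 + g₁ ^ 2 + g₂ ^ 2 + g₃ ^ 2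
    + p.τ * |p.δ₂| * h ^ 2
  dissipation : (p.δ₁ - |p.δ₂|) * zx ^ 2 ≤ p.κ₁ * (f₁ * ux) + p.κ₂ * (f₂ * vx) + p.κ₃ * (f₃ * wx)
    + g₁ * y + g₂ * z + g₃ * ϕ + p.τ * |p.δ₂| * (h * η)
  η₁_sq_le : η₁ ^ 2 ≤ zx ^ 2 + 2 * (p.τ * h * η)
  η_sq_le : η ^ 2 ≤ zx ^ 2 + 2 * (p.τ * h * η)
  abs_mul_vx_le : |l| * vx ≤ zx + f₂
  poincare : z ≤ (p.β - p.α) * zx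
  qx_le : qx ≤ p.κ₂ * vx + p.δ₁ * zx + |p.δ₂| * η₁
  qxx_le : qxx ≤ |l| * z + g₂
  trace_flux_α : (p.β - p.α) * (p.κ₁ * Sα) ^ 2 ≤ qx ^ 2 + (p.β - p.α) * (2 * (qxx * qx))
  trace_flux_β : (p.β - p.α) * (p.κ₃ * Sβ) ^ 2 ≤ qx ^ 2 + (p.β - p.α) * (2 * (qxx * qx))
  trace_z_α : (p.β - p.α) * Zα ^ 2 ≤ z ^ 2 + (p.β - p.α) * (2 * (zx * z))
  trace_z_β : (p.β - p.α) * Zβ ^ 2 ≤ z ^ 2 + (p.β - p.α) * (2 * (zx * z))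
  abs_mul_z_sq_le : |l| * z ^ 2 ≤ p.κ₁ * Sα * Zα + p.κ₃ * Sβ * Zβ + qx * zx + g₂ * z
  left_le : p.κ₁ * ux ^ 2 + y ^ 2 ≤ p.α * (p.κ₁ * Sα ^ 2 + Zα ^ 2 + 2 * (g₁ * ux + f₁ * y))
  right_le : p.κ₃ * wx ^ 2 + ϕ ^ 2
    ≤ (p.L - p.β) * (p.κ₃ * Sβ ^ 2 + Zβ ^ 2 + 2 * (g₃ * wx + f₃ * ϕ))

/-- All use of the differential equations and interface conditions is collected here; later
estimates only manipulate real numbers. -/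
theorem IsA2.resolventBounds {p : Params} (hα : 0 < p.α) (hαβ : p.α < p.β) (hβL : p.β < p.L)
    (hκ₁ : 0 < p.κ₁) (hκ₂ : 0 < p.κ₂) (hκ₃ : 0 < p.κ₃) (hτ : 0 < p.τ) (hδ₁ : 0 < p.δ₁)
    {U V F : Energy p} {l : ℝ} (hUV : IsA2 U V) (hF : (Complex.I * (l : ℂ)) • U - V = F) :
    Nonempty (ResolventBounds p l (energyNorm U) (energyNorm F)) := by
  obtain ⟨Y, η₀, η₁, ηρ, uxx, qxx, wxx, hY, hη, hη0, hη1, hz, hu, hq, hw, ⟨t, hqα, huα⟩,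
    ⟨s, hqβ, hwβ⟩, rfl⟩ := hUV
  have hy : U.2.1.1 = Y.left.fn := congrArg (fun q : LL2 p => q.1) hY.symm
  have hzz : (U.2.1.2.1 : L2 p.α p.β ℂ) = Y.mid.toH1.fn :=
    congrArg (fun q : LL2 p => (q.2.1 : L2 p.α p.β ℂ)) hY.symm
  have hϕ : U.2.1.2.2 = Y.right.fn := congrArg (fun q : LL2 p => q.2.2) hY.symm
  have F1 : F.1.left.dx = (Complex.I * (l : ℂ)) • U.1.left.dx - Y.left.dx := by rw [← hF]; rfl
  have F2 : F.1.mid.dx = (Complex.I * (l : ℂ)) • U.1.mid.dx - Y.mid.dx := by rw [← hF]; rfl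
  have F3 : F.1.right.dx = (Complex.I * (l : ℂ)) • U.1.right.dx - Y.right.dx := by rw [← hF]; rfl
  have G1 : F.2.1.1 = (Complex.I * (l : ℂ)) • Y.left.fn - (p.κ₁ : ℂ) • uxx := by
    rw [← hF, ← hy]; rfl
  have G2 : (F.2.1.2.1 : L2 p.α p.β ℂ) = (Complex.I * (l : ℂ)) • Y.mid.toH1.fn - qxx := by
    rw [← hF, ← hzz]; rfl
  have G3 : F.2.1.2.2 = (Complex.I * (l : ℂ)) • Y.right.fn - (p.κ₃ : ℂ) • wxx := by
    rw [← hF, ← hϕ]; rfl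
  have HF : L2.dx F.2.2 = (Complex.I * (l : ℂ)) • L2.dx U.2.2 + (p.τ : ℂ)⁻¹ • L2.dx ηρ := by
    have : F.2.2 = (Complex.I * (l : ℂ)) • U.2.2 + (p.τ : ℂ)⁻¹ • ηρ := by
      rw [← hF, ← sub_neg_eq_add]; rfl
    rw [this, L2.dx_add, L2.dx_smul, L2.dx_smul]
  have hflux : (flux U.1.mid Y.mid η₁).dx
      = p.κ₂ • U.1.mid.dx + p.δ₁ • Y.mid.dx + p.δ₂ • η₁.dx := by
    rw [← L2.ofReal_smul, ← L2.ofReal_smul, ← L2.ofReal_smul]; rfl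
  subst hz
  obtain ⟨hY0, ⟨zα, hyα, hzα⟩, ⟨zβ, hzβ, hϕβ⟩, hϕL⟩ := Y.2
  change HasTrace 0 p.α Y.left.fn 0 0 at hY0
  change HasTrace 0 p.α Y.left.fn p.α zα at hyα
  change HasTrace p.α p.β Y.mid.toH1.fn p.α zα at hzα
  change HasTrace p.α p.β Y.mid.toH1.fn p.β zβ at hzβ
  change HasTrace p.β p.L Y.right.fn p.β zβ at hϕβ
  change HasTrace p.β p.L Y.right.fn p.L 0 at hϕL
  have dy : HasWeakDeriv 0 p.α Y.left.fn Y.left.dx := Y.left.hasWeakDeriv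
  have dz : HasWeakDeriv p.α p.β Y.mid.toH1.fn Y.mid.dx := Y.mid.toH1.hasWeakDeriv
  have dϕ : HasWeakDeriv p.β p.L Y.right.fn Y.right.dx := Y.right.hasWeakDeriv
  have dθ := hη.dx
  have mα := left_mem_Icc.2 hαβ.le
  have mβ := right_mem_Icc.2 hαβ.le
  have m0 : (0 : ℝ) ∈ Icc (0 : ℝ) 1 := left_mem_Icc.2 zero_le_one
  have m1 : (1 : ℝ) ∈ Icc (0 : ℝ) 1 := right_mem_Icc.2 zero_le_one
  have Lα : ‖(p.κ₁ : ℂ) * t‖ = p.κ₁ * ‖t‖ := by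
    rw [norm_mul, Complex.norm_real, Real.norm_of_nonneg hκ₁.le]
  have Lβ : ‖(p.κ₃ : ℂ) * s‖ = p.κ₃ * ‖s‖ := by
    rw [norm_mul, Complex.norm_real, Real.norm_of_nonneg hκ₃.le]
  have hnl : ‖Complex.I * (l : ℂ)‖ = |l| := by
    rw [norm_mul, Complex.norm_I, one_mul, Complex.norm_real, Real.norm_eq_abs]
  have I0 := fun {a b : ℝ} => L2.inner_I_smul_self (a := a) (b := b) Complex.inner_I_smul_self
  -- The last equation solved for `η_ρ`; the term with `iτl` is skew and drops out of `⟨η_ρ, η⟩`.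
  have hθρ : L2.dx ηρ
      = (p.τ : ℂ) • L2.dx F.2.2 - (Complex.I * ((p.τ * l : ℝ) : ℂ)) • L2.dx U.2.2 := by
    have hτ' : (p.τ : ℂ) ≠ 0 := by exact_mod_cast hτ.ne'
    rw [HF, smul_add, smul_smul, smul_smul, mul_inv_cancel₀ hτ', one_smul]
    push_cast
    rw [mul_left_comm]
    abel
  have hθ : ∀ᵐ ρ ∂volume.restrict (Ioo (0 : ℝ) 1), inner ℝ (L2.dx ηρ ρ) (L2.dx U.2.2 ρ)
      = inner ℝ (((p.τ : ℂ) • L2.dx F.2.2 : L2 0 1 (L2 p.α p.β ℂ)) ρ) (L2.dx U.2.2 ρ) := by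
    rw [hθρ]
    filter_upwards [Lp.coeFn_sub ((p.τ : ℂ) • L2.dx F.2.2)
        ((Complex.I * ((p.τ * l : ℝ) : ℂ)) • L2.dx U.2.2),
      Lp.coeFn_smul (Complex.I * ((p.τ * l : ℝ) : ℂ)) (L2.dx U.2.2)] with ρ h1 h2
    rw [h1, Pi.sub_apply, h2, Pi.smul_apply, inner_sub_left, I0, sub_zero]
  have hHn : ‖(p.τ : ℂ) • L2.dx F.2.2‖ = p.τ * ‖L2.dx F.2.2‖ := by
    rw [norm_smul, Complex.norm_real, Real.norm_of_nonneg hτ.le]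
  have hdiss : (p.δ₁ - |p.δ₂|) * ‖Y.mid.dx‖ ^ 2 ≤ (energyInner F U).re := by
    -- Integration by parts needs some value of `u_x(0)` and `w_x(L)`; both are multiplied by `y(0)
    -- = 0` and `ϕ(L) = 0`. The interface terms cancel between neighbouring intervals by the
    -- transmission conditions.
    obtain ⟨u0, hu0⟩ := hu.exists_hasTrace hα 0
    obtain ⟨wL, hwL⟩ := hw.exists_hasTrace hβL p.L
    have E1 := dy.inner_add_inner hα hu hY0 hyα hu0 huα
    have E2 := dz.inner_add_inner hαβ hq hzα hzβ hqα hqβ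
    have E3 := dϕ.inner_add_inner hβL hw hϕβ hϕL hwβ hwL
    have E4 := dθ.inner_add_inner one_pos dθ hη0.dx hη1.dx hη0.dx hη1.dx
    have EH : p.τ * |p.δ₂| * inner ℝ (L2.dx F.2.2) (L2.dx U.2.2)
        = |p.δ₂| * inner ℝ (L2.dx ηρ) (L2.dx U.2.2) := by
      have hs : inner ℝ ((p.τ : ℂ) • L2.dx F.2.2) (L2.dx U.2.2)
          = p.τ * inner ℝ (L2.dx F.2.2) (L2.dx U.2.2) := by
        have e : (p.τ : ℂ) • L2.dx F.2.2 = p.τ • L2.dx F.2.2 := by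
          refine Lp.ext ?_
          filter_upwards [Lp.coeFn_smul (p.τ : ℂ) (L2.dx F.2.2),
            Lp.coeFn_smul p.τ (L2.dx F.2.2)] with x h1 h2
          rw [h1, h2, Pi.smul_apply, Pi.smul_apply, L2.ofReal_smul]
        rw [e, real_inner_smul_left]
      rw [hθρ, inner_sub_left, hs, L2.inner_I_smul_self I0]
      ring
    rw [re_energyInner, hy, hzz, hϕ, F1, F2, F3, G1, G2, G3, EH]
    simp only [inner_sub_left, I0, L2.ofReal_smul, real_inner_smul_left, zero_sub]
    rw [hflux] at E2
    simp only [inner_add_right, real_inner_smul_right, inner_zero_left, zero_sub, sub_zero,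
      ← Complex.real_smul] at E1 E2 E3
    rw [real_inner_comm (L2.dx ηρ) (L2.dx U.2.2), real_inner_self_eq_norm_sq,
      real_inner_self_eq_norm_sq] at E4
    rw [real_inner_self_eq_norm_sq] at E2
    rw [real_inner_comm Y.left.fn, real_inner_comm Y.mid.toH1.fn, real_inner_comm Y.right.fn]
    -- Young's inequality with equal weights: the `η_x(1)` part cancels exactly against the boundary
    -- term of the delay at `ρ = 1`.
    have hcs : -(|p.δ₂| * ((‖Y.mid.dx‖ ^ 2 + ‖η₁.dx‖ ^ 2) / 2))
        ≤ p.δ₂ * inner ℝ Y.mid.dx η₁.dx := by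
      have h1 := neg_abs_le (p.δ₂ * inner ℝ Y.mid.dx η₁.dx)
      rw [abs_mul] at h1
      have h2 := abs_real_inner_le_norm Y.mid.dx η₁.dx
      have h3 : |inner ℝ Y.mid.dx η₁.dx| ≤ (‖Y.mid.dx‖ ^ 2 + ‖η₁.dx‖ ^ 2) / 2 := by
        linarith [two_mul_le_add_sq ‖Y.mid.dx‖ ‖η₁.dx‖]
      linarith [mul_le_mul_of_nonneg_left h3 (abs_nonneg p.δ₂)]
    linear_combination hcs + p.κ₁ * E1 + E2 + p.κ₃ * E3 - |p.δ₂| / 2 * E4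
  have hFU : (energyInner F U).re ≤ p.κ₁ * (‖F.1.left.dx‖ * ‖U.1.left.dx‖)
      + p.κ₂ * (‖F.1.mid.dx‖ * ‖U.1.mid.dx‖) + p.κ₃ * (‖F.1.right.dx‖ * ‖U.1.right.dx‖)
      + ‖F.2.1.1‖ * ‖U.2.1.1‖
      + ‖(F.2.1.2.1 : L2 p.α p.β ℂ)‖ * ‖(U.2.1.2.1 : L2 p.α p.β ℂ)‖
      + ‖F.2.1.2.2‖ * ‖U.2.1.2.2‖ + p.τ * |p.δ₂| * (‖L2.dx F.2.2‖ * ‖L2.dx U.2.2‖) := by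
    rw [re_energyInner]
    gcongr <;> exact real_inner_le_norm _ _
  have hqα' := hq.norm_sq_trace_le hαβ mα hqα
  have hqβ' := hq.norm_sq_trace_le hαβ mβ hqβ
  rw [Lα] at hqα'
  rw [Lβ] at hqβ'
  have hsub : ∀ {a b : ℝ} {f f' g : L2 a b ℂ}, f = (Complex.I * (l : ℂ)) • g - f' →
      f' = (Complex.I * (l : ℂ)) • g - f := fun h => by rw [h]; abel
  -- Pairing `q_xx = ilz - g₂` with `iz` rather than `z` makes the term `l‖z‖²` appear in the real
  -- part.
  have hIz : |l| * ‖Y.mid.toH1.fn‖ ^ 2 ≤ p.κ₁ * ‖t‖ * ‖zα‖ + p.κ₃ * ‖s‖ * ‖zβ‖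
      + ‖(flux U.1.mid Y.mid η₁).dx‖ * ‖Y.mid.dx‖
      + ‖(F.2.1.2.1 : L2 p.α p.β ℂ)‖ * ‖Y.mid.toH1.fn‖ := by
    have E := hq.inner_add_inner hαβ (dz.smul Complex.I) hqα hqβ (hzα.smul Complex.I)
      (hzβ.smul Complex.I)
    have e1 : inner ℝ ((Complex.I * (l : ℂ)) • Y.mid.toH1.fn) (Complex.I • Y.mid.toH1.fn)
        = l * ‖Y.mid.toH1.fn‖ ^ 2 := by
      rw [mul_comm, mul_smul, L2.ofReal_smul, real_inner_smul_left, real_inner_self_eq_norm_sq,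
        norm_smul, Complex.norm_I, one_mul]
    have e2 : l * ‖Y.mid.toH1.fn‖ ^ 2
        = inner ℝ (F.2.1.2.1 : L2 p.α p.β ℂ) (Complex.I • Y.mid.toH1.fn)
          + inner ℝ ((p.κ₃ : ℂ) * s) (Complex.I • zβ) - inner ℝ ((p.κ₁ : ℂ) * t) (Complex.I • zα)
          - inner ℝ (flux U.1.mid Y.mid η₁).dx (Complex.I • Y.mid.dx) := by
      rw [G2, inner_sub_left, e1]
      linarith
    have b : ∀ {E : Type} [NormedAddCommGroup E] [InnerProductSpace ℝ E] [NormedSpace ℂ E]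
        (x y : E), |inner ℝ x (Complex.I • y)| ≤ ‖x‖ * ‖y‖ := fun x y => by
      simpa [norm_smul] using abs_real_inner_le_norm x (Complex.I • y)
    have b1 := b (F.2.1.2.1 : L2 p.α p.β ℂ) Y.mid.toH1.fn
    have b2 := b ((p.κ₃ : ℂ) * s) zβ
    have b3 := b ((p.κ₁ : ℂ) * t) zα
    have b4 := b (flux U.1.mid Y.mid η₁).dx Y.mid.dx
    rw [Lβ] at b2
    rw [Lα] at b3
    have e3 : |l| * ‖Y.mid.toH1.fn‖ ^ 2 = |l * ‖Y.mid.toH1.fn‖ ^ 2| := by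
      rw [abs_mul, abs_of_nonneg (sq_nonneg ‖Y.mid.toH1.fn‖)]
    rw [e3, e2]
    rw [abs_le] at b1 b2 b3 b4 ⊢
    constructor <;> linarith [b1.1, b1.2, b2.1, b2.2, b3.1, b3.2, b4.1, b4.2]
  -- The first order system is in the pair `(u_x, y)`: `κ₁ u_xx = ily - g₁` and `y_x = ilu_x - f₁`.
  have hlα := wave_norm_sq_le hα hu dy (hsub G1) (hsub F1)
    (right_mem_Icc.2 hα.le) huα hyα
  have hlβ := wave_norm_sq_le hβL hw dϕ (hsub G3) (hsub F3)
    (left_mem_Icc.2 hβL.le) hwβ hϕβ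
  rw [sub_zero] at hlα
  have hη1' := dθ.norm_sq_trace_le_add one_pos hθ m0 hη0.dx m1 hη1.dx
  have hη' := dθ.norm_sq_le one_pos hθ m0 hη0.dx
  rw [hHn] at hη1' hη'
  rw [sub_zero, one_mul] at hη'
  exact ⟨{
    ux := ‖U.1.left.dx‖
    vx := ‖U.1.mid.dx‖
    wx := ‖U.1.right.dx‖
    y := ‖U.2.1.1‖
    z := ‖(U.2.1.2.1 : L2 p.α p.β ℂ)‖
    ϕ := ‖U.2.1.2.2‖
    η := ‖L2.dx U.2.2‖
    f₁ := ‖F.1.left.dx‖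
    f₂ := ‖F.1.mid.dx‖
    f₃ := ‖F.1.right.dx‖
    g₁ := ‖F.2.1.1‖
    g₂ := ‖(F.2.1.2.1 : L2 p.α p.β ℂ)‖
    g₃ := ‖F.2.1.2.2‖
    h := ‖L2.dx F.2.2‖
    zx := ‖Y.mid.dx‖
    qx := ‖(flux U.1.mid Y.mid η₁).dx‖
    qxx := ‖(qxx : L2 p.α p.β ℂ)‖
    η₁ := ‖η₁.dx‖
    Sα := ‖t‖
    Sβ := ‖s‖
    Zα := ‖zα‖
    Zβ := ‖zβ‖
    N_nonneg := Real.sqrt_nonneg _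
    Φ_nonneg := Real.sqrt_nonneg _
    vx_nonneg := norm_nonneg _
    z_nonneg := norm_nonneg _
    ϕ_nonneg := norm_nonneg _
    η_nonneg := norm_nonneg _
    f₁_nonneg := norm_nonneg _
    f₂_nonneg := norm_nonneg _
    f₃_nonneg := norm_nonneg _
    g₁_nonneg := norm_nonneg _
    g₂_nonneg := norm_nonneg _
    g₃_nonneg := norm_nonneg _
    zx_nonneg := norm_nonneg _
    qx_nonneg := norm_nonneg _
    qxx_nonneg := norm_nonneg _
    η₁_nonneg := norm_nonneg _
    Sα_nonneg := norm_nonneg _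
    Sβ_nonneg := norm_nonneg _
    Zα_nonneg := norm_nonneg _
    Zβ_nonneg := norm_nonneg _
    N_sq := energyNorm_sq hκ₁ hκ₂ hκ₃ hτ U
    Φ_sq := energyNorm_sq hκ₁ hκ₂ hκ₃ hτ F
    dissipation := hdiss.trans hFU
    η₁_sq_le := hη1'
    η_sq_le := hη'
    abs_mul_vx_le := by
      rw [← hnl, ← norm_smul, ← sub_add_cancel ((Complex.I * (l : ℂ)) • U.1.mid.dx) Y.mid.dx, ← F2,
        add_comm]
      exact norm_add_le _ _
    poincare := by
      rw [hzz]
      exact dz.norm_le_of_integral_eq_zero hαβ Y.mid.2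
    qx_le := by
      rw [hflux]
      refine (norm_add₃_le).trans (le_of_eq ?_)
      rw [norm_smul, norm_smul, norm_smul, Real.norm_of_nonneg hκ₂.le, Real.norm_of_nonneg hδ₁.le,
        Real.norm_eq_abs]
    qxx_le := by
      rw [hsub G2, hzz, ← hnl, ← norm_smul]
      exact norm_sub_le _ _
    trace_flux_α := hqα'
    trace_flux_β := hqβ'
    trace_z_α := by
      rw [hzz]
      exact dz.norm_sq_trace_le hαβ mα hzα
    trace_z_β := by
      rw [hzz]
      exact dz.norm_sq_trace_le hαβ mβ hzβ
    abs_mul_z_sq_le := by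
      rw [hzz]
      exact hIz
    left_le := by
      rw [hy]
      exact hlα
    right_le := by
      rw [hϕ]
      exact hlβ }⟩

/-! ### Scalar estimates in the low and high frequency regimes -/

section Resolvent

theorem mul_mul_le_of_mul_sq_le {k a b A B : ℝ} (hA : 0 ≤ A) (hB : 0 ≤ B)
    (ha : k * a ^ 2 ≤ A ^ 2) (hb0 : 0 ≤ k * b ^ 2) (hb : k * b ^ 2 ≤ B ^ 2) :
    k * (a * b) ≤ A * B := by
  refine (abs_le.1 (abs_le_of_sq_le_sq ?_ (mul_nonneg hA hB))).2
  calc (k * (a * b)) ^ 2 = (k * a ^ 2) * (k * b ^ 2) := by ring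
    _ ≤ A ^ 2 * B ^ 2 := mul_le_mul ha hb hb0 (sq_nonneg _)
    _ = _ := by ring

/-- The sharp constant is `√(k⁻¹)`; `1 + k⁻¹` is a larger, rational substitute. -/
theorem mul_le_of_mul_sq_le {k a b A B : ℝ} (hk : 0 < k) (hA : 0 ≤ A) (hB : 0 ≤ B)
    (ha : a ^ 2 ≤ A ^ 2) (hb : k * b ^ 2 ≤ B ^ 2) : a * b ≤ (1 + k⁻¹) * (A * B) := by
  have h : a * b ≤ Real.sqrt k⁻¹ * (A * B) := by
    refine (abs_le.1 (abs_le_of_sq_le_sq ?_ (by positivity))).2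
    rw [mul_pow, mul_pow, Real.sq_sqrt (by positivity), ← div_eq_inv_mul, le_div_iff₀ hk]
    calc a ^ 2 * b ^ 2 * k = a ^ 2 * (k * b ^ 2) := by ring
      _ ≤ A ^ 2 * B ^ 2 := mul_le_mul ha hb (by positivity) (sq_nonneg _)
      _ = _ := by ring
  refine h.trans (mul_le_mul_of_nonneg_right ?_ (mul_nonneg hA hB))
  rw [Real.sqrt_le_left (by positivity)]
  nlinarith [inv_pos.2 hk]

variable {p : Params}

/-- Cauchy–Schwarz bounds for the components of the solution and the data. -/
theorem ResolventBounds.mul_norm_bounds (hκ₁ : 0 < p.κ₁) (hκ₂ : 0 < p.κ₂) (hκ₃ : 0 < p.κ₃)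
    (hτ : 0 < p.τ) {l N Φ : ℝ} (B : ResolventBounds p l N Φ) :
    (p.δ₁ - |p.δ₂|) * B.zx ^ 2 ≤ 7 * (Φ * N) ∧ p.τ * |p.δ₂| * (B.h * B.η) ≤ Φ * N ∧
      p.κ₂ * B.f₂ ^ 2 ≤ Φ ^ 2 ∧ B.g₂ ^ 2 ≤ Φ ^ 2 ∧
      B.g₁ * B.ux + B.f₁ * B.y ≤ 2 * ((1 + p.κ₁⁻¹) * (Φ * N)) ∧
      B.g₃ * B.wx + B.f₃ * B.ϕ ≤ 2 * ((1 + p.κ₃⁻¹) * (Φ * N)) := by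
  have N0 := B.N_nonneg
  have Φ0 := B.Φ_nonneg
  have hN := B.N_sq
  have hΦ := B.Φ_sq
  have p1 : 0 ≤ p.κ₁ * B.ux ^ 2 := by positivity
  have p2 : 0 ≤ p.κ₂ * B.vx ^ 2 := by positivity
  have p3 : 0 ≤ p.κ₃ * B.wx ^ 2 := by positivity
  have p4 := sq_nonneg B.y
  have p5 := sq_nonneg B.z
  have p6 := sq_nonneg B.ϕ
  have p7 : 0 ≤ p.τ * |p.δ₂| * B.η ^ 2 := by positivity
  have q1 : 0 ≤ p.κ₁ * B.f₁ ^ 2 := by positivity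
  have q2 : 0 ≤ p.κ₂ * B.f₂ ^ 2 := by positivity
  have q3 : 0 ≤ p.κ₃ * B.f₃ ^ 2 := by positivity
  have q4 := sq_nonneg B.g₁
  have q5 := sq_nonneg B.g₂
  have q6 := sq_nonneg B.g₃
  have q7 : 0 ≤ p.τ * |p.δ₂| * B.h ^ 2 := by positivity
  have t1 := mul_mul_le_of_mul_sq_le (k := p.κ₁) (a := B.f₁) (b := B.ux) Φ0 N0 (by linarith) p1
    (by linarith)
  have t2 := mul_mul_le_of_mul_sq_le (k := p.κ₂) (a := B.f₂) (b := B.vx) Φ0 N0 (by linarith) p2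
    (by linarith)
  have t3 := mul_mul_le_of_mul_sq_le (k := p.κ₃) (a := B.f₃) (b := B.wx) Φ0 N0 (by linarith) p3
    (by linarith)
  have t4 := mul_mul_le_of_mul_sq_le (k := 1) (a := B.g₁) (b := B.y) Φ0 N0 (by linarith)
    (by linarith) (by linarith)
  have t5 := mul_mul_le_of_mul_sq_le (k := 1) (a := B.g₂) (b := B.z) Φ0 N0 (by linarith)
    (by linarith) (by linarith)
  have t6 := mul_mul_le_of_mul_sq_le (k := 1) (a := B.g₃) (b := B.ϕ) Φ0 N0 (by linarith)
    (by linarith) (by linarith)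
  have t7 := mul_mul_le_of_mul_sq_le (k := p.τ * |p.δ₂|) (a := B.h) (b := B.η) Φ0 N0 (by linarith)
    p7 (by linarith)
  have s1 := mul_le_of_mul_sq_le (a := B.g₁) (b := B.ux) hκ₁ Φ0 N0 (by linarith) (by linarith)
  have s2 := mul_le_of_mul_sq_le (a := B.y) (b := B.f₁) hκ₁ N0 Φ0 (by linarith) (by linarith)
  have s3 := mul_le_of_mul_sq_le (a := B.g₃) (b := B.wx) hκ₃ Φ0 N0 (by linarith) (by linarith)
  have s4 := mul_le_of_mul_sq_le (a := B.ϕ) (b := B.f₃) hκ₃ N0 Φ0 (by linarith) (by linarith)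
  -- The constant `7` counts the terms of the dissipation bound, each at most `Φ * N`.
  exact ⟨by linarith [B.dissipation], t7, by linarith, by linarith, by linarith, by linarith⟩

/-- The quantities controlled by the dissipation. -/
theorem ResolventBounds.exists_dissipative_bounds (hαβ : p.α < p.β)
    (hκ₁ : 0 < p.κ₁) (hκ₂ : 0 < p.κ₂) (hκ₃ : 0 < p.κ₃) (hτ : 0 < p.τ)
    (hδ₂ : p.δ₂ ≠ 0) (hδ : |p.δ₂| < p.δ₁) :
    ∃ a : ℝ, 1 ≤ a ∧ ∀ (l N Φ r : ℝ) (B : ResolventBounds p l N Φ), 0 ≤ r →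
      r ^ 2 = Φ * N + Φ ^ 2 → B.zx ≤ a * r ∧ B.η₁ ≤ a * r ∧ B.η ≤ a * r ∧ |l| * B.vx ≤ a * r ∧
        B.z ≤ a * r ∧ B.g₂ ≤ a * r ∧ B.g₁ * B.ux + B.f₁ * B.y ≤ a * r ^ 2 ∧
        B.g₃ * B.wx + B.f₃ * B.ϕ ≤ a * r ^ 2 := by
  have hδ₂' : 0 < |p.δ₂| := abs_pos.2 hδ₂
  have hd : 0 < p.δ₁ - |p.δ₂| := sub_pos.2 hδ
  have hℓ : 0 < p.β - p.α := sub_pos.2 hαβ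
  -- `A₁` bounds `zx² / r²`. `A₂` adds the source term `2τhη ≤ (2/|δ₂|) r²` of the delay. `A`
  -- exceeds every constant needed and is at least `1`, so that `x² ≤ A r²` gives `x ≤ A r`.
  set A₁ := 7 / (p.δ₁ - |p.δ₂|) with hA₁
  set A₂ := A₁ + 2 / |p.δ₂| with hA₂
  set A := 2 * A₂ + 2 / p.κ₂ + (p.β - p.α) ^ 2 * A₁ + 1 with hA
  have hA₁0 : 0 < A₁ := by positivity
  have hA₂0 : 0 < A₂ := by positivity
  have hk₂ : 0 < 2 / p.κ₂ := by positivity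
  have hℓA : 0 ≤ (p.β - p.α) ^ 2 * A₁ := by positivity
  have hAA₁ : A₁ ≤ A₂ := by
    have : 0 < 2 / |p.δ₂| := by positivity
    linarith
  have hA1 : 1 ≤ A := by linarith
  clear_value A₁ A₂ A
  have hi₁ : 0 < p.κ₁⁻¹ := inv_pos.2 hκ₁
  have hi₃ : 0 < p.κ₃⁻¹ := inv_pos.2 hκ₃
  refine ⟨A + 2 * (1 + p.κ₁⁻¹) + 2 * (1 + p.κ₃⁻¹), by linarith, fun l N Φ r B hr hR => ?_⟩
  have N0 := B.N_nonneg
  have Φ0 := B.Φ_nonneg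
  obtain ⟨t1, t7, hf₂, hg₂, s1, s3⟩ := B.mul_norm_bounds hκ₁ hκ₂ hκ₃ hτ
  have hΦN : 0 ≤ Φ * N := mul_nonneg Φ0 N0
  have hΦNR : Φ * N ≤ r ^ 2 := by linarith [sq_nonneg Φ]
  have hΦR : Φ ^ 2 ≤ r ^ 2 := by linarith
  have hr2 : 0 ≤ r ^ 2 := sq_nonneg r
  have hzx : B.zx ^ 2 ≤ A₁ * r ^ 2 := by
    rw [hA₁, div_mul_eq_mul_div, le_div_iff₀ hd]
    linarith
  have hhη : 2 * (p.τ * B.h * B.η) ≤ 2 / |p.δ₂| * r ^ 2 := by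
    rw [div_mul_eq_mul_div, le_div_iff₀ hδ₂']
    linarith
  have of_sq : ∀ x K : ℝ, K ≤ A → x ^ 2 ≤ K * r ^ 2 → x ≤ A * r := by
    intro x K hK hx
    refine (abs_le.1 (abs_le_of_sq_le_sq ?_ (by positivity))).2
    calc x ^ 2 ≤ K * r ^ 2 := hx
      _ ≤ A * r ^ 2 := by gcongr
      _ ≤ A * A * r ^ 2 := by gcongr; nlinarith
      _ = _ := by ring
  have mono : ∀ x : ℝ, x ≤ A * r → x ≤ (A + 2 * (1 + p.κ₁⁻¹) + 2 * (1 + p.κ₃⁻¹)) * r := by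
    intro x hx
    refine hx.trans ?_
    gcongr
    linarith
  have u1 : (1 + p.κ₁⁻¹) * (Φ * N) ≤ (1 + p.κ₁⁻¹) * r ^ 2 := by gcongr
  have u3 : (1 + p.κ₃⁻¹) * (Φ * N) ≤ (1 + p.κ₃⁻¹) * r ^ 2 := by gcongr
  have v0 : 0 ≤ A * r ^ 2 := by positivity
  have v1 : 0 ≤ (1 + p.κ₁⁻¹) * r ^ 2 := by positivity
  have v3 : 0 ≤ (1 + p.κ₃⁻¹) * r ^ 2 := by positivity
  refine ⟨mono _ (of_sq _ A₁ (by linarith) hzx), mono _ (of_sq _ A₂ (by linarith) ?_),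
    mono _ (of_sq _ A₂ (by linarith) ?_),
    mono _ (of_sq _ (2 * A₁ + 2 / p.κ₂) (by linarith) ?_),
    mono _ (of_sq _ ((p.β - p.α) ^ 2 * A₁) (by linarith) ?_), mono _ (of_sq _ 1 hA1 (by linarith)),
    by linarith, by linarith⟩
  · rw [hA₂, add_mul]
    linarith only [B.η₁_sq_le, hzx, hhη]
  · rw [hA₂, add_mul]
    linarith only [B.η_sq_le, hzx, hhη]
  · have h1 : (|l| * B.vx) ^ 2 ≤ (B.zx + B.f₂) ^ 2 := by
      have := B.vx_nonneg
      have := B.abs_mul_vx_le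
      gcongr
    have h2 : B.f₂ ^ 2 ≤ 1 / p.κ₂ * r ^ 2 := by
      rw [div_mul_eq_mul_div, le_div_iff₀ hκ₂]
      linarith
    calc (|l| * B.vx) ^ 2 ≤ 2 * (B.zx ^ 2 + B.f₂ ^ 2) := h1.trans add_sq_le
      _ ≤ 2 * (A₁ * r ^ 2 + 1 / p.κ₂ * r ^ 2) := by gcongr
      _ = _ := by ring
  · calc B.z ^ 2 ≤ ((p.β - p.α) * B.zx) ^ 2 := by
          have := B.z_nonneg
          have := B.poincare
          gcongr
      _ = (p.β - p.α) ^ 2 * B.zx ^ 2 := by ring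
      _ ≤ (p.β - p.α) ^ 2 * (A₁ * r ^ 2) := by gcongr
      _ = _ := by ring

/-- The energy is controlled by the dissipation and the traces at the interfaces. -/
theorem ResolventBounds.exists_sq_le (hα : 0 < p.α) (hαβ : p.α < p.β) (hβL : p.β < p.L)
    (hκ₁ : 0 < p.κ₁) (hκ₂ : 0 < p.κ₂) (hκ₃ : 0 < p.κ₃) (hτ : 0 < p.τ)
    (hδ₂ : p.δ₂ ≠ 0) (hδ : |p.δ₂| < p.δ₁) (c : ℝ) (hc : 0 < c) :
    ∃ C : ℝ, 0 < C ∧ ∀ (l N Φ W : ℝ) (B : ResolventBounds p l N Φ), Φ * N + Φ ^ 2 ≤ W →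
      B.vx ^ 2 ≤ c * W → B.Sα ^ 2 ≤ c * W → B.Sβ ^ 2 ≤ c * W → B.Zα ^ 2 ≤ c * W →
      B.Zβ ^ 2 ≤ c * W → N ^ 2 ≤ C * W := by
  obtain ⟨a, ha, H⟩ := exists_dissipative_bounds hαβ hκ₁ hκ₂ hκ₃ hτ hδ₂ hδ
  have hℓ : 0 < p.L - p.β := sub_pos.2 hβL
  -- The summands bound the left string, `v_x`, the right string, `z` and `η`. `W` is `r²` with a
  -- frequency weight: `r² / l²` or `√|l| r²` in the applications.
  refine ⟨p.α * (p.κ₁ * c + c + 2 * a) + p.κ₂ * c + (p.L - p.β) * (p.κ₃ * c + c + 2 * a) + a ^ 2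
    + p.τ * |p.δ₂| * a ^ 2, by positivity, fun l N Φ W B hW hv hSα hSβ hZα hZβ => ?_⟩
  have hR : 0 ≤ Φ * N + Φ ^ 2 := by
    have := B.N_nonneg
    have := B.Φ_nonneg
    positivity
  obtain ⟨-, -, h3, -, h5, -, h7, h8⟩ := H l N Φ _ B (Real.sqrt_nonneg _) (Real.sq_sqrt hR)
  rw [Real.sq_sqrt hR] at h7 h8
  have hsq : ∀ x : ℝ, 0 ≤ x → x ≤ a * Real.sqrt (Φ * N + Φ ^ 2) → x ^ 2 ≤ a ^ 2 * W := by
    intro x hx0 hx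
    calc x ^ 2 ≤ (a * Real.sqrt (Φ * N + Φ ^ 2)) ^ 2 := by gcongr
      _ = a ^ 2 * (Φ * N + Φ ^ 2) := by rw [mul_pow, Real.sq_sqrt hR]
      _ ≤ a ^ 2 * W := by gcongr
  have e3 := hsq _ B.η_nonneg h3
  have e5 := hsq _ B.z_nonneg h5
  have e7 : B.g₁ * B.ux + B.f₁ * B.y ≤ a * W := h7.trans (by gcongr)
  have e8 : B.g₃ * B.wx + B.f₃ * B.ϕ ≤ a * W := h8.trans (by gcongr)
  have hl : p.κ₁ * B.ux ^ 2 + B.y ^ 2 ≤ p.α * ((p.κ₁ * c + c + 2 * a) * W) := by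
    refine B.left_le.trans (mul_le_mul_of_nonneg_left ?_ hα.le)
    linarith [mul_le_mul_of_nonneg_left hSα hκ₁.le]
  have hr : p.κ₃ * B.wx ^ 2 + B.ϕ ^ 2 ≤ (p.L - p.β) * ((p.κ₃ * c + c + 2 * a) * W) := by
    refine B.right_le.trans (mul_le_mul_of_nonneg_left ?_ hℓ.le)
    linarith [mul_le_mul_of_nonneg_left hSβ hκ₃.le]
  rw [B.N_sq]
  linarith [mul_le_mul_of_nonneg_left hv hκ₂.le,
    mul_le_mul_of_nonneg_left e3 (mul_nonneg hτ.le (abs_nonneg p.δ₂))]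

/-- After multiplication by `|l| ≤ 1` every quantity in the flux is at most a multiple of `r`; only
`v_x` really needs this factor. -/
theorem ResolventBounds.exists_sq_le_of_abs_le_one (hα : 0 < p.α) (hαβ : p.α < p.β)
    (hβL : p.β < p.L) (hκ₁ : 0 < p.κ₁) (hκ₂ : 0 < p.κ₂) (hκ₃ : 0 < p.κ₃) (hτ : 0 < p.τ)
    (hδ₂ : p.δ₂ ≠ 0) (hδ : |p.δ₂| < p.δ₁) :
    ∃ C : ℝ, 0 < C ∧ ∀ (l N Φ : ℝ), ResolventBounds p l N Φ → l ≠ 0 → |l| ≤ 1 →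
      N ^ 2 ≤ C * ((Φ * N + Φ ^ 2) / l ^ 2) := by
  obtain ⟨a, ha, H⟩ := exists_dissipative_bounds hαβ hκ₁ hκ₂ hκ₃ hτ hδ₂ hδ
  have hℓ : 0 < p.β - p.α := sub_pos.2 hαβ
  have hδ₁ : 0 < p.δ₁ := (abs_nonneg _).trans_lt hδ
  set b := (p.κ₂ + p.δ₁ + |p.δ₂|) * a with hb
  have hb0 : 0 < b := by positivity
  set c₁ := (b ^ 2 / (p.β - p.α) + 4 * a * b) with hc₁
  set c₂ := (a ^ 2 / (p.β - p.α) + 2 * a ^ 2) with hc₂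
  have hc₁0 : 0 < c₁ := by positivity
  have hc₂0 : 0 < c₂ := by positivity
  clear_value b c₁ c₂
  obtain ⟨C, hC, K⟩ := exists_sq_le hα hαβ hβL hκ₁ hκ₂ hκ₃ hτ hδ₂ hδ
    (a ^ 2 + c₁ / p.κ₁ ^ 2 + c₁ / p.κ₃ ^ 2 + c₂) (by positivity)
  refine ⟨C, hC, fun l N Φ B hl hl1 => ?_⟩
  have hR : 0 ≤ Φ * N + Φ ^ 2 := by
    have := B.N_nonneg
    have := B.Φ_nonneg
    positivity
  obtain ⟨h1, h2, -, h4, h5, h6, -, -⟩ := H l N Φ _ B (Real.sqrt_nonneg _) (Real.sq_sqrt hR)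
  have hrR := Real.sq_sqrt hR
  set r := Real.sqrt (Φ * N + Φ ^ 2) with hr
  have hr0 : 0 ≤ r := Real.sqrt_nonneg _
  clear_value r
  have hl0 : 0 < |l| := abs_pos.2 hl
  have hl2 : 0 < l ^ 2 := by positivity
  have hzx0 := B.zx_nonneg
  have hη0 := B.η₁_nonneg
  have hz0 := B.z_nonneg
  have hqx0 := B.qx_nonneg
  have hqxx0 := B.qxx_nonneg
  have hvx0 := B.vx_nonneg
  have hlx : ∀ x : ℝ, 0 ≤ x → |l| * x ≤ x := fun x hx => mul_le_of_le_one_left hx hl1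
  have hqx : |l| * B.qx ≤ b * r := by
    calc |l| * B.qx ≤ |l| * (p.κ₂ * B.vx + p.δ₁ * B.zx + |p.δ₂| * B.η₁) := by
          gcongr; exact B.qx_le
      _ = p.κ₂ * (|l| * B.vx) + p.δ₁ * (|l| * B.zx) + |p.δ₂| * (|l| * B.η₁) := by ring
      _ ≤ p.κ₂ * (a * r) + p.δ₁ * (a * r) + |p.δ₂| * (a * r) := by
          have k1 := (hlx _ hzx0).trans h1
          have k2 := (hlx _ hη0).trans h2
          refine add_le_add (add_le_add ?_ ?_) ?_ <;> gcongr
      _ = _ := by rw [hb]; ring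
  have hqxx : |l| * B.qxx ≤ 2 * a * r := by
    refine (hlx _ hqxx0).trans (B.qxx_le.trans ?_)
    linarith [hlx _ hz0]
  -- Here `S` is `κ₁Sα` or `κ₃Sβ`. The constant `c₁` is the trace inequality evaluated at `|l| qx ≤
  -- b r` and `|l| qxx ≤ 2 a r`.
  have tr : ∀ S : ℝ, (p.β - p.α) * S ^ 2 ≤ B.qx ^ 2 + (p.β - p.α) * (2 * (B.qxx * B.qx)) →
      S ^ 2 * l ^ 2 ≤ c₁ * r ^ 2 := by
    intro S hS
    have h := mul_le_mul_of_nonneg_right hS hl2.le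
    have e1 : (|l| * B.qx) ^ 2 ≤ (b * r) ^ 2 := by gcongr
    have e2 : (|l| * B.qxx) * (|l| * B.qx) ≤ (2 * a * r) * (b * r) := by gcongr
    have e3 : (p.β - p.α) * (S ^ 2 * l ^ 2) ≤ (p.β - p.α) * (c₁ * r ^ 2) := by
      have e4 : (p.β - p.α) * (c₁ * r ^ 2) = (b * r) ^ 2
          + (p.β - p.α) * (2 * ((2 * a * r) * (b * r))) := by
        rw [hc₁]
        field_simp
        ring
      have e5 : (B.qx ^ 2 + (p.β - p.α) * (2 * (B.qxx * B.qx))) * l ^ 2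
          = (|l| * B.qx) ^ 2 + (p.β - p.α) * (2 * ((|l| * B.qxx) * (|l| * B.qx))) := by
        rw [← sq_abs l]
        ring
      rw [e4]
      rw [e5] at h
      linarith [mul_le_mul_of_nonneg_left e2 hℓ.le]
    exact le_of_mul_le_mul_left e3 hℓ
  have trz : ∀ Z : ℝ, (p.β - p.α) * Z ^ 2 ≤ B.z ^ 2 + (p.β - p.α) * (2 * (B.zx * B.z)) →
      Z ^ 2 * l ^ 2 ≤ c₂ * r ^ 2 := by
    intro Z hZ
    have e1 : B.z ^ 2 ≤ (a * r) ^ 2 := by gcongr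
    have e2 : B.zx * B.z ≤ (a * r) * (a * r) := by gcongr
    have e3 : (p.β - p.α) * Z ^ 2 ≤ (p.β - p.α) * (c₂ * r ^ 2) := by
      have e4 : (p.β - p.α) * (c₂ * r ^ 2) = (a * r) ^ 2
          + (p.β - p.α) * (2 * ((a * r) * (a * r))) := by
        rw [hc₂]
        field_simp
      rw [e4]
      linarith [mul_le_mul_of_nonneg_left e2 hℓ.le]
    have hl2' : l ^ 2 ≤ 1 := by
      rw [← sq_abs]
      exact pow_le_one₀ hl0.le hl1
    exact (mul_le_of_le_one_right (sq_nonneg _) hl2').trans (le_of_mul_le_mul_left e3 hℓ)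
  have fin : ∀ x k : ℝ, k ≤ a ^ 2 + c₁ / p.κ₁ ^ 2 + c₁ / p.κ₃ ^ 2 + c₂ →
      x ^ 2 * l ^ 2 ≤ k * r ^ 2 →
      x ^ 2 ≤ (a ^ 2 + c₁ / p.κ₁ ^ 2 + c₁ / p.κ₃ ^ 2 + c₂) * ((Φ * N + Φ ^ 2) / l ^ 2) := by
    intro x k hk hx
    rw [← mul_div_assoc, le_div_iff₀ hl2, ← hrR]
    exact hx.trans (by gcongr)
  have k1 : 0 < c₁ / p.κ₁ ^ 2 := by positivity
  have k3 : 0 < c₁ / p.κ₃ ^ 2 := by positivity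
  have ka : 0 < a ^ 2 := by positivity
  refine K l N Φ _ B ?_ (fin _ (a ^ 2) (by linarith) ?_) (fin _ (c₁ / p.κ₁ ^ 2) (by linarith) ?_)
    (fin _ (c₁ / p.κ₃ ^ 2) (by linarith) ?_) (fin _ c₂ (by linarith) (trz _ B.trace_z_α))
    (fin _ c₂ (by linarith) (trz _ B.trace_z_β))
  · rw [le_div_iff₀ hl2]
    refine mul_le_of_le_one_right hR ?_
    rw [← sq_abs]
    exact pow_le_one₀ hl0.le hl1
  · calc B.vx ^ 2 * l ^ 2 = (|l| * B.vx) ^ 2 := by rw [mul_pow, sq_abs, mul_comm]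
      _ ≤ (a * r) ^ 2 := by gcongr
      _ = _ := by ring
  · rw [div_mul_eq_mul_div, le_div_iff₀ (by positivity)]
    linarith [tr _ B.trace_flux_α]
  · rw [div_mul_eq_mul_div, le_div_iff₀ (by positivity)]
    linarith [tr _ B.trace_flux_β]

/-- The crude bound `z ≲ r` would lose a full power of `|l|` in `qxx`. Bootstrapping to `√|l| z ≲ r`
reduces the loss to `√|l|`. -/
theorem ResolventBounds.exists_sq_le_of_one_le_abs (hα : 0 < p.α) (hαβ : p.α < p.β)
    (hβL : p.β < p.L) (hκ₁ : 0 < p.κ₁) (hκ₂ : 0 < p.κ₂) (hκ₃ : 0 < p.κ₃) (hτ : 0 < p.τ)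
    (hδ₂ : p.δ₂ ≠ 0) (hδ : |p.δ₂| < p.δ₁) :
    ∃ C : ℝ, 0 < C ∧ ∀ (l N Φ : ℝ), ResolventBounds p l N Φ → 1 ≤ |l| →
      N ^ 2 ≤ C * (Real.sqrt |l| * (Φ * N + Φ ^ 2)) := by
  obtain ⟨a, ha, H⟩ := exists_dissipative_bounds hαβ hκ₁ hκ₂ hκ₃ hτ hδ₂ hδ
  have hℓ : 0 < p.β - p.α := sub_pos.2 hαβ
  have hδ₁ : 0 < p.δ₁ := (abs_nonneg _).trans_lt hδ
  set b := (p.κ₂ + p.δ₁ + |p.δ₂|) * a with hb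
  have hb0 : 0 < b := by positivity
  -- One constant for all traces: the first three terms serve the flux, the last two serve `z`. `D`
  -- below collects the four terms of `abs_mul_z_sq_le`.
  set c₁ := b ^ 2 / (p.β - p.α) + 2 * a * b + 2 * b + a / (p.β - p.α) + 2 * a with hc₁
  have hc₁0 : 0 < c₁ := by positivity
  set D := 2 * c₁ + a * b + a ^ 2 with hD
  have hD0 : 0 < D := by positivity
  clear_value b c₁ D
  set c := a ^ 2 + c₁ * (D + 2) / p.κ₁ ^ 2 + c₁ * (D + 2) / p.κ₃ ^ 2 + c₁ * (D + 2) with hc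
  obtain ⟨C, hC, K⟩ := exists_sq_le hα hαβ hβL hκ₁ hκ₂ hκ₃ hτ hδ₂ hδ c (by positivity)
  clear_value c
  refine ⟨C, hC, fun l N Φ B hl1 => ?_⟩
  have hR : 0 ≤ Φ * N + Φ ^ 2 := by
    have := B.N_nonneg
    have := B.Φ_nonneg
    positivity
  obtain ⟨h1, h2, -, h4, h5, h6, -, -⟩ := H l N Φ _ B (Real.sqrt_nonneg _) (Real.sq_sqrt hR)
  have hrR := Real.sq_sqrt hR
  set r := Real.sqrt (Φ * N + Φ ^ 2) with hr
  have hr0 : 0 ≤ r := Real.sqrt_nonneg _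
  clear_value r
  have hml := Real.sq_sqrt (abs_nonneg l)
  have hm1 : 1 ≤ Real.sqrt |l| := Real.one_le_sqrt.2 hl1
  set m := Real.sqrt |l| with hm
  have hm0 : 0 < m := by linarith
  clear_value m
  have hzx0 := B.zx_nonneg
  have hz0 := B.z_nonneg
  have hqx0 := B.qx_nonneg
  have hqxx0 := B.qxx_nonneg
  have hvx0 := B.vx_nonneg
  have hg0 := B.g₂_nonneg
  have hvx : B.vx ≤ a * r := (le_mul_of_one_le_left hvx0 hl1).trans h4
  have hqx : B.qx ≤ b * r := by
    calc B.qx ≤ p.κ₂ * B.vx + p.δ₁ * B.zx + |p.δ₂| * B.η₁ := B.qx_le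
      _ ≤ p.κ₂ * (a * r) + p.δ₁ * (a * r) + |p.δ₂| * (a * r) := by gcongr
      _ = _ := by rw [hb]; ring
  -- The rescaled unknown, with `m² = |l|` and hence `s² = |l| z²`; the aim is `s ≲ r`.
  set s := m * B.z with hs
  have hs0 : 0 ≤ s := by positivity
  clear_value s
  have hqxx : B.qxx ≤ m * s + a * r := by
    refine B.qxx_le.trans (le_of_eq_of_le (b := m * s + B.g₂) ?_ (by linarith))
    rw [← hml, hs]
    ring
  have tr : ∀ S : ℝ, (p.β - p.α) * S ^ 2 ≤ B.qx ^ 2 + (p.β - p.α) * (2 * (B.qxx * B.qx)) →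
      S ^ 2 ≤ c₁ * (r ^ 2 + m * (r * s)) := by
    intro S hS
    have e1 : B.qx ^ 2 ≤ (b * r) ^ 2 := by gcongr
    have e2 : B.qxx * B.qx ≤ (m * s + a * r) * (b * r) := by gcongr
    have e3 : (p.β - p.α) * S ^ 2
        ≤ (p.β - p.α) * ((b ^ 2 / (p.β - p.α) + 2 * a * b) * r ^ 2 + 2 * b * (m * (r * s))) := by
      have e4 : (p.β - p.α) * ((b ^ 2 / (p.β - p.α) + 2 * a * b) * r ^ 2 + 2 * b * (m * (r * s)))
          = (b * r) ^ 2 + (p.β - p.α) * (2 * ((m * s + a * r) * (b * r))) := by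
        field_simp
        ring
      rw [e4]
      linarith [mul_le_mul_of_nonneg_left e2 hℓ.le]
    refine (le_of_mul_le_mul_left e3 hℓ).trans ?_
    rw [mul_add c₁]
    have : 0 < b ^ 2 / (p.β - p.α) := by positivity
    have : 0 < a / (p.β - p.α) := by positivity
    have : 0 < a * b := by positivity
    gcongr <;> linarith
  have trz : ∀ Z : ℝ, (p.β - p.α) * Z ^ 2 ≤ B.z ^ 2 + (p.β - p.α) * (2 * (B.zx * B.z)) →
      m * Z ^ 2 ≤ c₁ * (r * s) := by
    intro Z hZ
    have e1 : B.z * B.z ≤ (a * r) * B.z := by gcongr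
    have e2 : B.zx * B.z ≤ (a * r) * B.z := by gcongr
    have e3 : (p.β - p.α) * Z ^ 2 ≤ (p.β - p.α) * ((a / (p.β - p.α) + 2 * a) * (r * B.z)) := by
      have e4 : (p.β - p.α) * ((a / (p.β - p.α) + 2 * a) * (r * B.z)) = (a * r) * B.z
          + (p.β - p.α) * (2 * ((a * r) * B.z)) := by
        field_simp
      rw [e4]
      linarith [mul_le_mul_of_nonneg_left e2 hℓ.le]
    calc m * Z ^ 2 ≤ m * ((a / (p.β - p.α) + 2 * a) * (r * B.z)) :=
          mul_le_mul_of_nonneg_left (le_of_mul_le_mul_left e3 hℓ) hm0.le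
      _ = (a / (p.β - p.α) + 2 * a) * (r * s) := by rw [hs]; ring
      _ ≤ c₁ * (r * s) := by
        have : 0 < b ^ 2 / (p.β - p.α) := by positivity
        have : 0 < a * b := by positivity
        gcongr
        linarith
  -- The factor `m` in the bound for `S²` is compensated by the gain `1/m` for `Z²`, so the product
  -- is bounded uniformly in the frequency.
  have prod : ∀ S Z : ℝ, S ^ 2 ≤ c₁ * (r ^ 2 + m * (r * s)) → m * Z ^ 2 ≤ c₁ * (r * s) →
      S * Z ≤ c₁ * (r ^ 2 + r * s) := by
    intro S Z hS hZ
    refine (abs_le.1 (abs_le_of_sq_le_sq ?_ (by positivity))).2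
    have hrs : 0 ≤ r * s := by positivity
    have e1 : m * (S * Z) ^ 2 ≤ m * ((c₁ * (r ^ 2 + r * s)) * (c₁ * (r * s))) := by
      calc m * (S * Z) ^ 2 = S ^ 2 * (m * Z ^ 2) := by ring
        _ ≤ (c₁ * (r ^ 2 + m * (r * s))) * (c₁ * (r * s)) := by gcongr
        _ ≤ (c₁ * (m * r ^ 2 + m * (r * s))) * (c₁ * (r * s)) := by
          gcongr
          exact le_mul_of_one_le_left (sq_nonneg r) hm1
        _ = _ := by ring
    refine (le_of_mul_le_mul_left e1 hm0).trans ?_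
    rw [sq (c₁ * _)]
    gcongr
    linarith [sq_nonneg r]
  have hSα := tr _ B.trace_flux_α
  have hSβ := tr _ B.trace_flux_β
  have hZα := trz _ B.trace_z_α
  have hZβ := trz _ B.trace_z_β
  have hsr : s ≤ (D + 1) * r := by
    have e1 : s ^ 2 ≤ D * (r ^ 2 + r * s) := by
      have e2 : s ^ 2 = |l| * B.z ^ 2 := by rw [hs, mul_pow, hml]
      have e3 : B.qx * B.zx ≤ (b * r) * (a * r) := by gcongr
      have e4 : B.g₂ * B.z ≤ (a * r) * (a * r) := by gcongr
      have e5 : 0 ≤ (a * b + a ^ 2) * (r * s) := by positivity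
      rw [e2, hD]
      linarith [B.abs_mul_z_sq_le, prod _ _ hSα hZα, prod _ _ hSβ hZβ]
    -- If `s > (D + 1) r`, then `s² ≥ (D + 1) r s ≥ D r s + (D + 1) r²`, which contradicts `e1` when
    -- `r > 0`; when `r = 0`, `e1` forces `s = 0`.
    by_contra! hlt
    have e2 : (D + 1) * r * s ≤ s * s := by gcongr
    have e3 : r * ((D + 1) * r) ≤ r * s := by gcongr
    have e4 : 0 < s := lt_of_le_of_lt (by positivity) hlt
    rcases hr0.eq_or_lt with h0 | h0
    · rw [← h0] at e1
      have : 0 < s ^ 2 := by positivity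
      linarith
    · have : 0 < r ^ 2 := by positivity
      linarith
  have hrs : r * s ≤ (D + 1) * r ^ 2 := by
    calc r * s ≤ r * ((D + 1) * r) := by gcongr
      _ = _ := by ring
  have hmr : r ^ 2 ≤ m * r ^ 2 := le_mul_of_one_le_left (sq_nonneg r) hm1
  have fin : ∀ x k : ℝ, k ≤ c → x ^ 2 ≤ k * (m * r ^ 2) →
      x ^ 2 ≤ c * (m * (Φ * N + Φ ^ 2)) := by
    intro x k hk hx
    rw [← hrR]
    exact hx.trans (by gcongr)
  have trS : ∀ S : ℝ, S ^ 2 ≤ c₁ * (r ^ 2 + m * (r * s)) → S ^ 2 ≤ c₁ * (D + 2) * (m * r ^ 2) := by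
    intro S hS
    refine hS.trans ?_
    rw [mul_assoc]
    gcongr
    linarith [mul_le_mul_of_nonneg_left hrs hm0.le]
  have trZ : ∀ Z : ℝ, m * Z ^ 2 ≤ c₁ * (r * s) → Z ^ 2 ≤ c₁ * (D + 2) * (m * r ^ 2) := by
    intro Z hZ
    refine (le_mul_of_one_le_left (sq_nonneg Z) hm1).trans (hZ.trans ?_)
    rw [mul_assoc]
    refine mul_le_mul_of_nonneg_left (hrs.trans (mul_le_mul (by linarith) hmr (sq_nonneg r)
      (by linarith))) hc₁0.le
  have k1 : 0 < c₁ * (D + 2) / p.κ₁ ^ 2 := by positivity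
  have k3 : 0 < c₁ * (D + 2) / p.κ₃ ^ 2 := by positivity
  have k2 : 0 < c₁ * (D + 2) := by positivity
  have ka : 0 < a ^ 2 := by positivity
  refine K l N Φ _ B (by rw [← hrR]; exact hmr) (fin _ (a ^ 2) (by linarith) ?_)
    (fin _ (c₁ * (D + 2) / p.κ₁ ^ 2) (by linarith) ?_)
    (fin _ (c₁ * (D + 2) / p.κ₃ ^ 2) (by linarith) ?_)
    (fin _ (c₁ * (D + 2)) (by linarith) (trZ _ hZα))
    (fin _ (c₁ * (D + 2)) (by linarith) (trZ _ hZβ))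
  · calc B.vx ^ 2 ≤ (a * r) ^ 2 := by gcongr
      _ = a ^ 2 * r ^ 2 := by ring
      _ ≤ _ := by gcongr
  · rw [div_mul_eq_mul_div, le_div_iff₀ (by positivity)]
    linarith [trS _ hSα]
  · rw [div_mul_eq_mul_div, le_div_iff₀ (by positivity)]
    linarith [trS _ hSβ]

/-- The resolvent estimates for `𝓐₂` at high and at low frequencies. -/
theorem exists_energyNorm_sq_le (hα : 0 < p.α) (hαβ : p.α < p.β)
    (hβL : p.β < p.L) (hκ₁ : 0 < p.κ₁) (hκ₂ : 0 < p.κ₂) (hκ₃ : 0 < p.κ₃) (hτ : 0 < p.τ)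
    (hδ₁ : 0 < p.δ₁) (hδ₂ : p.δ₂ ≠ 0) (hδ : |p.δ₂| < p.δ₁) :
    ∃ C : ℝ, 0 < C ∧ ∀ (l : ℝ) (U : (A2 p).domain) (F : Energy p), l ≠ 0 →
      (Complex.I * (l : ℂ)) • (U : Energy p) - A2 p U = F →
      (1 ≤ |l| → energyNorm (U : Energy p) ^ 2 ≤ C * |l| ^ (1 / 2 : ℝ) *
        (energyNorm F * energyNorm (U : Energy p) + energyNorm F ^ 2)) ∧
      (|l| ≤ 1 → energyNorm (U : Energy p) ^ 2 ≤ C * (|l| ^ 2)⁻¹ *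
        (energyNorm F * energyNorm (U : Energy p) + energyNorm F ^ 2)) := by
  obtain ⟨C₁, h₁, H₁⟩ :=
    ResolventBounds.exists_sq_le_of_one_le_abs hα hαβ hβL hκ₁ hκ₂ hκ₃ hτ hδ₂ hδ
  obtain ⟨C₂, h₂, H₂⟩ :=
    ResolventBounds.exists_sq_le_of_abs_le_one hα hαβ hβL hκ₁ hκ₂ hκ₃ hτ hδ₂ hδ
  refine ⟨C₁ + C₂, by positivity, fun l U F hl hF => ?_⟩
  obtain ⟨B⟩ := (mem_graph_A2.1 ((A2 p).mem_graph U)).resolventBounds hα hαβ hβL hκ₁ hκ₂ hκ₃ hτ hδ₁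
    hF
  have hR : 0 ≤ energyNorm F * energyNorm (U : Energy p) + energyNorm F ^ 2 := by
    have := B.N_nonneg
    have := B.Φ_nonneg
    positivity
  refine ⟨fun h => (H₁ _ _ _ B h).trans ?_, fun h => (H₂ _ _ _ B hl h).trans ?_⟩
  · rw [← Real.sqrt_eq_rpow, mul_assoc]
    gcongr
    linarith
  · rw [sq_abs, mul_assoc, div_eq_inv_mul]
    gcongr
    linarith

end Resolvent

end KVDelay

end

/-! ### Comparison of the two regimes with the stated weights -/

theorem proposition3p3 (p : KVDelay.Params)
    (hα : 0 < p.α) (hαβ : p.α < p.β) (hβL : p.β < p.L)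
    (hκ₁ : 0 < p.κ₁) (hκ₂ : 0 < p.κ₂) (hκ₃ : 0 < p.κ₃) (hτ : 0 < p.τ)
    (hδ₁ : 0 < p.δ₁) (hδ₂ : p.δ₂ ≠ 0) (hδ : |p.δ₂| < p.δ₁) :
    (∃ K₁ : ℝ, 0 < K₁ ∧
      ∀ (lam : ℝ) (U : (KVDelay.A2 p).domain) (F : KVDelay.Energy p), lam ≠ 0 →
        (Complex.I * (lam : ℂ)) • (U : KVDelay.Energy p) - KVDelay.A2 p U = F →
        KVDelay.energyNorm (U : KVDelay.Energy p) ^ 2 ≤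
          K₁ * lam ^ (-4 : ℤ) * (|lam| + 1) ^ 6 *
            (KVDelay.energyNorm F * KVDelay.energyNorm (U : KVDelay.Energy p)
              + KVDelay.energyNorm F ^ 2)) ∧
    (∃ K₂ : ℝ, 0 < K₂ ∧
      ∀ (M lam : ℝ) (U : (KVDelay.A2 p).domain) (F : KVDelay.Energy p), 0 < M → M ≤ |lam| →
        (Complex.I * (lam : ℂ)) • (U : KVDelay.Energy p) - KVDelay.A2 p U = F →
        KVDelay.energyNorm (U : KVDelay.Energy p) ^ 2 ≤
          K₂ * (Real.sqrt M + 1 / Real.sqrt M) ^ 2 * |lam| ^ (1 / 2 : ℝ)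
            * (1 + |lam| ^ (-(1 / 2) : ℝ)) ^ 8 *
            (KVDelay.energyNorm F * KVDelay.energyNorm (U : KVDelay.Energy p)
              + KVDelay.energyNorm F ^ 2)) := by
  obtain ⟨C, hC, H⟩ := KVDelay.exists_energyNorm_sq_le hα hαβ hβL hκ₁ hκ₂ hκ₃ hτ hδ₁ hδ₂ hδ
  have hR : ∀ U F : KVDelay.Energy p,
      0 ≤ KVDelay.energyNorm F * KVDelay.energyNorm U + KVDelay.energyNorm F ^ 2 := fun U F =>
    add_nonneg (mul_nonneg (Real.sqrt_nonneg _) (Real.sqrt_nonneg _)) (sq_nonneg _)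
  refine ⟨⟨C, hC, fun lam U F hl hF => ?_⟩, ⟨C, hC, fun M lam U F hM hMl hF => ?_⟩⟩
  · obtain ⟨h1, h2⟩ := H lam U F hl hF
    have hl0 : 0 < |lam| := abs_pos.2 hl
    have e : lam ^ (-4 : ℤ) = (|lam| ^ 4)⁻¹ := by
      rw [zpow_neg, (by decide : Even 4).pow_abs]
      rfl
    rw [e, mul_assoc C]
    rcases le_total 1 |lam| with h | h
    · refine (h1 h).trans (mul_le_mul_of_nonneg_right (mul_le_mul_of_nonneg_left ?_ hC.le) (hR _ _))
      rw [← div_eq_inv_mul, le_div_iff₀ (by positivity)]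
      -- There is room to spare: the power `9/2` would suffice where `6` is allowed.
      calc |lam| ^ (1 / 2 : ℝ) * |lam| ^ 4 ≤ |lam| ^ (1 : ℝ) * |lam| ^ 4 := by
            gcongr
            norm_num
        _ = |lam| ^ 5 := by rw [Real.rpow_one]; ring
        _ ≤ (|lam| + 1) ^ 5 := by gcongr; linarith
        _ ≤ (|lam| + 1) ^ 6 := by gcongr <;> linarith
    · refine (h2 h).trans (mul_le_mul_of_nonneg_right (mul_le_mul_of_nonneg_left ?_ hC.le) (hR _ _))
      calc (|lam| ^ 2)⁻¹ ≤ (|lam| ^ 4)⁻¹ := by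
            rw [inv_le_inv₀ (by positivity) (by positivity)]
            exact pow_le_pow_of_le_one hl0.le h (by norm_num)
        _ ≤ _ := le_mul_of_one_le_right (by positivity) (one_le_pow₀ (by linarith))
  · have hl0 : 0 < |lam| := hM.trans_le hMl
    obtain ⟨h1, h2⟩ := H lam U F (abs_pos.1 hl0) hF
    -- The square is `M + 2 + 1/M`, so the factor containing `M` only weakens the bound and `K₂` can
    -- be the same `C`.
    have hsM : 1 ≤ (Real.sqrt M + 1 / Real.sqrt M) ^ 2 := by
      have h0 := Real.sqrt_pos.2 hM
      have e : Real.sqrt M * (1 / Real.sqrt M) = 1 := mul_one_div_cancel h0.ne'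
      nlinarith [sq_nonneg (Real.sqrt M), sq_nonneg (1 / Real.sqrt M)]
    have hp0 : 0 < |lam| ^ (1 / 2 : ℝ) := Real.rpow_pos_of_pos hl0 _
    have hn0 : 0 < |lam| ^ (-(1 / 2) : ℝ) := Real.rpow_pos_of_pos hl0 _
    have key : ∀ x : ℝ, x ≤ |lam| ^ (1 / 2 : ℝ) * (1 + |lam| ^ (-(1 / 2) : ℝ)) ^ 8 →
        C * x ≤ C * (Real.sqrt M + 1 / Real.sqrt M) ^ 2 * |lam| ^ (1 / 2 : ℝ)
          * (1 + |lam| ^ (-(1 / 2) : ℝ)) ^ 8 := by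
      intro x hx
      rw [mul_assoc, mul_assoc]
      refine mul_le_mul_of_nonneg_left (hx.trans ?_) hC.le
      exact le_mul_of_one_le_left (by positivity) hsM
    rcases le_total 1 |lam| with h | h
    · refine (h1 h).trans (mul_le_mul_of_nonneg_right (key _ ?_) (hR _ _))
      exact le_mul_of_one_le_right hp0.le (one_le_pow₀ (by linarith))
    · refine (h2 h).trans (mul_le_mul_of_nonneg_right (key _ ?_) (hR _ _))
      -- Keeping only `|lam| ^ (-1/2)` in the eighth power leaves the exponent `1/2 - 4 = -7/2`,
      -- below `-2`, which suffices as `|lam| ≤ 1`.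
      calc (|lam| ^ 2)⁻¹ = |lam| ^ (-2 : ℝ) := by
            rw [Real.rpow_neg hl0.le, ← Real.rpow_natCast]
            norm_num
        _ ≤ |lam| ^ (-(7 / 2) : ℝ) :=
            Real.rpow_le_rpow_of_exponent_ge hl0 h (by norm_num)
        _ = |lam| ^ (1 / 2 : ℝ) * (|lam| ^ (-(1 / 2) : ℝ)) ^ 8 := by
            rw [← Real.rpow_natCast (|lam| ^ (-(1 / 2) : ℝ)) 8, ← Real.rpow_mul hl0.le,
              ← Real.rpow_add hl0]
            norm_num
        _ ≤ _ := by gcongr; linarith
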